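/- **Vocabularies and structures.** A vocabulary is a finite set of relation names with arities in $\{0,1,2,\ldots\}$; structures have non-empty universes. Classes of structures are closed under isomorphism, and first-order formulas may use equality. **Multiset types.** Multiset types are generated from $1$ by the constructors $\Sigma+\Gamma$, $\Sigma\times\Gamma$ and $\mathsf M\Sigma$. Each multiset type is viewed as a class of finite structures over a vocabulary, up to isomorphism, as follows. - $1$: the empty vocabulary, and the structures with exactly one element. - $\Sigma\times\Gamma$: the vocabulary is the disjoint union of those of $\Sigma$ and $\Gamma$, plus a new unary name $R$. The structures are the disjoint unions of some $A\in\Sigma$ and $B\in\Gamma$, where the relation names of $\Sigma$ are interpreted only by $A$ and those of $\Gamma$ only by $B$ (nullary relations keep their truth values), and $R$ is the set of elements coming from $A$. - $\Sigma+\Gamma$: the vocabulary is the disjoint union of those of $\Sigma$ and $\Gamma$, plus a new nullary name $R$. The structures are those of $\Sigma$ with $R$ true and all names of $\Gamma$ empty, and those of $\Gamma$ with $R$ false and all names of $\Sigma$ empty. - $\mathsf M\Sigma$: the vocabulary is that of $\Sigma$ with every nullary name made unary, plus a new binary name $\sim$. The structures are the disjoint unions of finitely many (possibly zero) $A_1,\ldots,A_m\in\Sigma$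 together with one extra element, the root, that participates in no relation. A formerly nullary name holds at exactly the elements of those $A_i$ in which it was true, and $\sim$ is the equivalence relation on the non-root elements whose classes are the universes of the $A_i$. **Non-copying interpretations.** A non-copying interpretation $f:\Gamma\to\Sigma$ is a first-order interpretation with one component, of dimension one. It consists of a first-order formula $\delta(x)$ over the vocabulary of $\Gamma$ and, for each $k$-ary relation name $R$ of $\Sigma$, a first-order formula $\theta_R(x_1,\ldots,x_k)$ over the vocabulary of $\Gamma$. For each $A\in\Gamma$, the structure $f(A)$ with universe $\{a\in A : A\models\delta(a)\}$, in which $R(\bar a)$ holds iff $A\models\theta_R(\bar a)$, is required to belong to $\Sigma$. The interpretation is surjective if every structure in $\Sigma$ is isomorphic to $f(A)$ for some $A\in\Gamma$. **Lemma (quantifier elimination).** For every multiset type $\Sigma$ and all integers $r,n\ge 0$ there are a multiset type $\Gamma$ and a surjective non-copying interpretation $f:\Gamma\to\Sigma$ such that for every first-order formula $\varphi(x_1,\ldots,x_n)$ of quantifier rank at most $r$ over the vocabulary of $\Sigma$ there is a quantifier-free formula $\psi(x_1,\ldots,x_n)$ over the vocabulary of $\Gamma$ such that for every structure $A\in\Gamma$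 and every tuple $\bar a\in A^n$: $$A,\bar a\models\psi\quad\Longleftrightarrow\quad\text{all elements of }\bar a\text{ are in the universe of }f(A)\text{ and }f(A),\bar a\models\varphi.$$ -/

import Mathlib

open FirstOrder CategoryTheory

universe u

/-- The syntax of multiset types: they are generated from the one-element type `1` by binary
disjoint unions, binary products and the finite-multiset constructor. -/
inductive MultisetType : Type
  | one : MultisetType
  | sum (σ τ : MultisetType) : MultisetType
  | prod (σ τ : MultisetType) : MultisetType
  | multiset (σ : MultisetType) : MultisetType

namespace MultisetType

/-! ### Products of classes of structures -/

/-- Relation names of a product: those of both factors and one new unary name. -/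
inductive ProdRel (L₁ L₂ : FirstOrder.Language.{0, 0}) : ℕ → Type
  | inl {k : ℕ} (R : L₁.Relations k) : ProdRel L₁ L₂ k
  | inr {k : ℕ} (R : L₂.Relations k) : ProdRel L₁ L₂ k
  | side : ProdRel L₁ L₂ 1

/-- The vocabulary of a product. -/
def prodVoc (L₁ L₂ : FirstOrder.Language.{0, 0}) : FirstOrder.Language.{0, 0} where
  Functions := fun _ => Empty
  Relations := ProdRel L₁ L₂

/-- The pair structure `(A, B)`: the disjoint union of `A` and `B`, where every relation name of one
factor is interpreted inside that factor only (a nullary relation keeps its truth value), and the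
new unary relation is the set of elements that come from `A`. -/
def pairStructure {L₁ L₂ : FirstOrder.Language.{0, 0}}
    (A : Bundled.{u} L₁.Structure) (B : Bundled.{u} L₂.Structure) :
    Bundled.{u} (prodVoc L₁ L₂).Structure where
  α := A ⊕ B
  str :=
    { funMap := fun F => Empty.elim F
      RelMap := fun {_} R => match R with
        | .inl R => fun x => ∃ y, x = Sum.inl ∘ y ∧ FirstOrder.Language.Structure.RelMap (M := A) R y
        | .inr R => fun x => ∃ y, x = Sum.inr ∘ y ∧ FirstOrder.Language.Structure.RelMap (M := B) R y
        | .side => fun x => ∃ a : A, x 0 = Sum.inl a }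

/-- The product of two classes of structures (closed under isomorphism). -/
def prodClass {L₁ L₂ : FirstOrder.Language.{0, 0}}
    (K₁ : Set (Bundled.{u} L₁.Structure)) (K₂ : Set (Bundled.{u} L₂.Structure)) :
    Set (Bundled.{u} (prodVoc L₁ L₂).Structure) :=
  {M | ∃ A ∈ K₁, ∃ B ∈ K₂, Nonempty (M ≃[prodVoc L₁ L₂] pairStructure A B)}

/-! ### Coproducts of classes of structures -/

/-- Relation names of a coproduct: those of both summands and one new nullary name. -/
inductive SumRel (L₁ L₂ : FirstOrder.Language.{0, 0}) : ℕ → Type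
  | inl {k : ℕ} (R : L₁.Relations k) : SumRel L₁ L₂ k
  | inr {k : ℕ} (R : L₂.Relations k) : SumRel L₁ L₂ k
  | isLeft : SumRel L₁ L₂ 0

/-- The vocabulary of a coproduct. -/
def sumVoc (L₁ L₂ : FirstOrder.Language.{0, 0}) : FirstOrder.Language.{0, 0} where
  Functions := fun _ => Empty
  Relations := SumRel L₁ L₂

/-- A structure of the left summand, viewed over the vocabulary of the coproduct: the relations of
the right summand are empty and the new nullary relation is true. -/
def leftStructure {L₁ : FirstOrder.Language.{0, 0}} (L₂ : FirstOrder.Language.{0, 0}) (A : Bundled.{u} L₁.Structure) :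
    Bundled.{u} (sumVoc L₁ L₂).Structure where
  α := A
  str :=
    { funMap := fun F => Empty.elim F
      RelMap := fun {_} R => match R with
        | .inl R => fun x => FirstOrder.Language.Structure.RelMap (M := A) R x
        | .inr _ => fun _ => False
        | .isLeft => fun _ => True }

/-- A structure of the right summand, viewed over the vocabulary of the coproduct: the relations of
the left summand are empty and the new nullary relation is false. -/
def rightStructure (L₁ : FirstOrder.Language.{0, 0}) {L₂ : FirstOrder.Language.{0, 0}} (B : Bundled.{u} L₂.Structure) :
    Bundled.{u} (sumVoc L₁ L₂).Structure where
  α := B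
  str :=
    { funMap := fun F => Empty.elim F
      RelMap := fun {_} R => match R with
        | .inl _ => fun _ => False
        | .inr R => fun x => FirstOrder.Language.Structure.RelMap (M := B) R x
        | .isLeft => fun _ => False }

/-- The coproduct of two classes of structures (closed under isomorphism). -/
def sumClass {L₁ L₂ : FirstOrder.Language.{0, 0}}
    (K₁ : Set (Bundled.{u} L₁.Structure)) (K₂ : Set (Bundled.{u} L₂.Structure)) :
    Set (Bundled.{u} (sumVoc L₁ L₂).Structure) :=
  {M | (∃ A ∈ K₁, Nonempty (M ≃[sumVoc L₁ L₂] leftStructure L₂ A)) ∨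
    ∃ B ∈ K₂, Nonempty (M ≃[sumVoc L₁ L₂] rightStructure L₁ B)}

/-! ### Multisets over a class of structures -/

/-- Relation names of a multiset type: the names of positive arity, a unary name for every nullary
name, and one new binary name. -/
inductive MultisetRel (L : FirstOrder.Language.{0, 0}) : ℕ → Type
  | old {k : ℕ} (R : L.Relations (k + 1)) : MultisetRel L (k + 1)
  | lifted (R : L.Relations 0) : MultisetRel L 1
  | sim : MultisetRel L 2

/-- The vocabulary of a multiset type. -/
def multisetVoc (L : FirstOrder.Language.{0, 0}) : FirstOrder.Language.{0, 0} where
  Functions := fun _ => Empty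
  Relations := MultisetRel L

/-- The structure of the multiset consisting of `A 0, …, A (m - 1)`: their disjoint union, together
with one extra element `none`, the root, that participates in no relation. A former nullary relation
holds at the elements of those `A i` in which it is true, and the new binary relation is the
equivalence relation on the non-root elements whose classes are the universes of the `A i`. -/
def multisetStructure {L : FirstOrder.Language.{0, 0}} {m : ℕ} (A : Fin m → Bundled.{u} L.Structure) :
    Bundled.{u} (multisetVoc L).Structure where
  α := Option (Σ i, A i)
  str :=
    { funMap := fun F => Empty.elim F
      RelMap := fun {_} R => match R with
        | .old R => fun x => ∃ (i : Fin m) (y : _ → A i),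
            x = (fun j => some ⟨i, y j⟩) ∧ FirstOrder.Language.Structure.RelMap (M := A i) R y
        | .lifted R => fun x => ∃ (i : Fin m) (a : A i),
            x 0 = some ⟨i, a⟩ ∧ FirstOrder.Language.Structure.RelMap (M := A i) R Fin.elim0
        | .sim => fun x => ∃ (i : Fin m) (a b : A i), x 0 = some ⟨i, a⟩ ∧ x 1 = some ⟨i, b⟩ }

/-- Finite multisets over a class of structures (closed under isomorphism). -/
def multisetClass {L : FirstOrder.Language.{0, 0}} (K : Set (Bundled.{u} L.Structure)) :
    Set (Bundled.{u} (multisetVoc L).Structure) :=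
  {M | ∃ (m : ℕ) (A : Fin m → Bundled.{u} L.Structure),
    (∀ i, A i ∈ K) ∧ Nonempty (M ≃[multisetVoc L] multisetStructure A)}

/-! ### Multiset types as classes of structures -/

/-- The (finite, relational) vocabulary of a multiset type. -/
def voc : MultisetType → FirstOrder.Language.{0, 0}
  | one => FirstOrder.Language.empty
  | sum σ τ => sumVoc σ.voc τ.voc
  | prod σ τ => prodVoc σ.voc τ.voc
  | multiset σ => multisetVoc σ.voc

instance voc_isRelational : (σ : MultisetType) → σ.voc.IsRelational
  | one => fun _ => inferInstanceAs (IsEmpty Empty)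
  | sum _ _ => fun _ => inferInstanceAs (IsEmpty Empty)
  | prod _ _ => fun _ => inferInstanceAs (IsEmpty Empty)
  | multiset _ => fun _ => inferInstanceAs (IsEmpty Empty)

/-- The class of structures described by a multiset type. -/
def structures : (σ : MultisetType) → Set (Bundled.{u} σ.voc.Structure)
  | one => {M | Nat.card M = 1}
  | sum σ τ => sumClass σ.structures τ.structures
  | prod σ τ => prodClass σ.structures τ.structures
  | multiset σ => multisetClass σ.structures

end MultisetType

/-- The quantifier rank of a formula: the maximal nesting depth of its quantifiers. -/
def quantifierRank {L : FirstOrder.Language.{0, 0}} {α : Type} : {k : ℕ} → L.BoundedFormula α k → ℕ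
  | _, .falsum => 0
  | _, .equal _ _ => 0
  | _, .rel _ _ => 0
  | _, .imp φ ψ => max (quantifierRank φ) (quantifierRank ψ)
  | _, .all φ => quantifierRank φ + 1

/-- The formulas of a non-copying first-order interpretation, that is, of a first-order
interpretation with a single component, which has dimension one: a universe formula with one free
variable, and for each output relation name of arity `k` a formula with `k` free variables. -/
structure NonCopyingInterpretation (L L' : FirstOrder.Language.{0, 0}) where
  univ : L.Formula (Fin 1)
  rel : ∀ {k : ℕ}, L'.Relations k → L.Formula (Fin k)

namespace NonCopyingInterpretation

/-- The element `a` of the input structure belongs to the universe of the output structure. -/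
def InUniverse {L L' : FirstOrder.Language.{0, 0}} (f : NonCopyingInterpretation L L')
    (A : Bundled.{u} L.Structure) (a : A) : Prop :=
  f.univ.Realize fun _ => a

/-- The output structure of a non-copying interpretation on the input structure `A`. -/
def apply {L L' : FirstOrder.Language.{0, 0}} [L'.IsRelational] (f : NonCopyingInterpretation L L')
    (A : Bundled.{u} L.Structure) : Bundled.{u} L'.Structure where
  α := {a : A // f.InUniverse A a}
  str :=
    { funMap := fun F => isEmptyElim F
      RelMap := fun R x => (f.rel R).Realize fun i => (x i).1 }

/-- `f` is a function from the class `K` to the class `K'`. -/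
def MapsClass {L L' : FirstOrder.Language.{0, 0}} [L'.IsRelational] (f : NonCopyingInterpretation L L')
    (K : Set (Bundled.{u} L.Structure)) (K' : Set (Bundled.{u} L'.Structure)) : Prop :=
  ∀ A ∈ K, f.apply A ∈ K'

/-- Every structure in `K'` is, up to isomorphism, the output of `f` on some structure in `K`. -/
def SurjectiveOnClass {L L' : FirstOrder.Language.{0, 0}} [L'.IsRelational]
    (f : NonCopyingInterpretation L L')
    (K : Set (Bundled.{u} L.Structure)) (K' : Set (Bundled.{u} L'.Structure)) : Prop :=
  ∀ B ∈ K', ∃ A ∈ K, Nonempty (f.apply A ≃[L'] B)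

end NonCopyingInterpretation

/-! Over a finite relational vocabulary, a property of tuples is definable without quantifiers
exactly when it depends only on the atomic type of the tuple (`exists_isQF_of_invariant`). It
therefore suffices to present each structure `B` of `σ` inside a structure `A` of another multiset
type so richly that atomic types in `A` decide Ehrenfeucht–Fraïssé games in `B`: a partial
isomorphism with `k` pairs is winning for `r` rounds whenever `k + r ≤ N`. Taking `N` at least `n +
r` settles the formulas of the lemma, and taking it at least every arity makes the relations of `B`
definable too, so that the presentation becomes an interpretation.

The induction on `σ` proves something stronger, `HasCover`: finitely many types cover `σ`, and
within each of them even partial isomorphisms that ignore nullary names are winning. Applied to the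
empty position, this says that all structures presented by one type of the cover agree up to `N`
rounds. Nullary names must be ignored because inside a multiset they become unary and tell nothing
about a component before one of its elements is touched. The information they would carry is moved
to the index of the cover. Only at the very end are the types of the cover merged by coproducts
(`HasCover.exists_isFullPres`), where nullary names record the index.

Products and coproducts are direct. The main case is `HasCover.multiset`. If the types `γ i` cover
`σ`, colour each component of a multiset by some `i` that presents it. A multiset is determined well
enough by its numbers of components of each colour, counted up to the threshold `N`. For a vector
`c` of such counts, take the product of a root, of `c i` copies of `γ i` for each `i`, and of one
factor `M (γ i)` for each `i` with `c i = N`, which absorbs the excess. All structures of this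
product have similar counts, and the duplicator wins by matching components of equal colour
(`Matched.ef`). The factors `M (γ i)` bring roots of their own, which lie outside the presented
structure; the universe formula removes them. -/

namespace FirstOrder.Language

open Structure

/-! ### Partial isomorphisms and Ehrenfeucht–Fraïssé games. -/

variable (L : Language.{0, 0})

/-- `p` preserves and reflects equality and all relations of positive arity. -/
structure PIsoPos {A B : Type u} [L.Structure A] [L.Structure B] (p : Set (A × B)) : Prop where
  eq_iff : ∀ {a b a' b'}, (a, b) ∈ p → (a', b') ∈ p → (a = a' ↔ b = b')
  rel_iff : ∀ {k : ℕ} (R : L.Relations (k + 1)) (x : Fin (k + 1) → A) (y : Fin (k + 1) → B),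
    (∀ i, (x i, y i) ∈ p) → (RelMap R x ↔ RelMap R y)

/-- `p` preserves and reflects equality and all relations, including the nullary ones. -/
structure PIso {A B : Type u} [L.Structure A] [L.Structure B] (p : Set (A × B)) : Prop where
  eq_iff : ∀ {a b a' b'}, (a, b) ∈ p → (a', b') ∈ p → (a = a' ↔ b = b')
  rel_iff : ∀ {k : ℕ} (R : L.Relations k) (x : Fin k → A) (y : Fin k → B),
    (∀ i, (x i, y i) ∈ p) → (RelMap R x ↔ RelMap R y)

/-- The duplicator wins the `r`-round Ehrenfeucht–Fraïssé game from the position `p`. -/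
def EF {A B : Type u} [L.Structure A] [L.Structure B] : ℕ → Set (A × B) → Prop
  | 0, p => L.PIso p
  | r + 1, p => L.PIso p ∧ (∀ a, ∃ b, EF r (insert (a, b) p)) ∧ ∀ b, ∃ a, EF r (insert (a, b) p)

/-- The position `p` pulled back along a pair of functions. -/
def pull {A B A' B' : Type u} (f : A' → A) (g : B' → B) (p : Set (A × B)) : Set (A' × B') :=
  {z | (f z.1, g z.2) ∈ p}

variable {L}

@[simp] theorem mem_pull {A B A' B' : Type u} {f : A' → A} {g : B' → B} {p : Set (A × B)}
    {z : A' × B'} : z ∈ pull f g p ↔ (f z.1, g z.2) ∈ p := Iff.rfl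

/-- Positions are measured by their number of pairs. Passing to a factor or a component along
injections must not exceed the budget `p.encard + r ≤ N`. -/
theorem encard_pull_le {A B A' B' : Type u} {f : A' → A} {g : B' → B} {p : Set (A × B)}
    (hf : f.Injective) (hg : g.Injective) : (pull f g p).encard ≤ p.encard := by
  have h : (Prod.map f g).Injective := hf.prodMap hg
  rw [← h.encard_image]
  apply Set.encard_le_encard
  rintro _ ⟨z, hz, rfl⟩
  exact hz

section

variable {A B A' B' : Type u} [L.Structure A] [L.Structure B] [L.Structure A'] [L.Structure B']

theorem PIso.pos {p : Set (A × B)} (h : L.PIso p) : L.PIsoPos p :=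
  ⟨h.eq_iff, fun R => h.rel_iff R⟩

theorem PIsoPos.mono {p q : Set (A × B)} (h : L.PIsoPos p) (hq : q ⊆ p) : L.PIsoPos q :=
  ⟨fun h₁ h₂ => h.eq_iff (hq h₁) (hq h₂), fun R x y hx => h.rel_iff R x y fun i => hq (hx i)⟩

theorem PIso.mono {p q : Set (A × B)} (h : L.PIso p) (hq : q ⊆ p) : L.PIso q :=
  ⟨fun h₁ h₂ => h.eq_iff (hq h₁) (hq h₂), fun R x y hx => h.rel_iff R x y fun i => hq (hx i)⟩

/-- This is where positive arity matters: a nullary name could distinguish the structures already at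
the empty position. It makes untouched components of the same kind comparable. -/
theorem PIsoPos.empty : L.PIsoPos (∅ : Set (A × B)) :=
  ⟨fun h => h.elim, fun _ _ _ h => (h 0).elim⟩

theorem PIsoPos.swap {p : Set (A × B)} (h : L.PIsoPos p) : L.PIsoPos (Prod.swap ⁻¹' p) :=
  ⟨fun h₁ h₂ => (h.eq_iff h₁ h₂).symm, fun R x y hx => (h.rel_iff R y x hx).symm⟩

theorem PIso.swap {p : Set (A × B)} (h : L.PIso p) : L.PIso (Prod.swap ⁻¹' p) :=
  ⟨fun h₁ h₂ => (h.eq_iff h₁ h₂).symm, fun R x y hx => (h.rel_iff R y x hx).symm⟩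

theorem EF.pIso {r : ℕ} {p : Set (A × B)} (h : L.EF r p) : L.PIso p := by
  cases r with
  | zero => exact h
  | succ r => exact h.1

/-- Forgetting pairs only helps the duplicator. Hence pulled-back positions need only be compared by
inclusion and never computed exactly. -/
theorem EF.mono {r : ℕ} {p q : Set (A × B)} (h : L.EF r p) (hq : q ⊆ p) : L.EF r q := by
  induction r generalizing p q with
  | zero => exact PIso.mono h hq
  | succ r ih =>
    refine ⟨h.1.mono hq, fun a => ?_, fun b => ?_⟩
    · obtain ⟨b, hb⟩ := h.2.1 a
      exact ⟨b, ih hb (Set.insert_subset_insert hq)⟩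
    · obtain ⟨a, ha⟩ := h.2.2 b
      exact ⟨a, ih ha (Set.insert_subset_insert hq)⟩

theorem EF.of_succ {r : ℕ} {p : Set (A × B)} (h : L.EF (r + 1) p) : L.EF r p := by
  induction r generalizing p with
  | zero => exact h.1
  | succ r ih =>
    refine ⟨h.1, fun a => ?_, fun b => ?_⟩
    · obtain ⟨b, hb⟩ := h.2.1 a
      exact ⟨b, ih hb⟩
    · obtain ⟨a, ha⟩ := h.2.2 b
      exact ⟨a, ih ha⟩

/-- A family of positions that consists of partial isomorphisms and has the back-and-forth
property is winning. -/
theorem EF.of_backForth (S : ℕ → Set (Set (A × B))) (h₀ : ∀ r, ∀ p ∈ S r, L.PIso p)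
    (forth : ∀ r, ∀ p ∈ S (r + 1), ∀ a, ∃ b, insert (a, b) p ∈ S r)
    (back : ∀ r, ∀ p ∈ S (r + 1), ∀ b, ∃ a, insert (a, b) p ∈ S r)
    {r : ℕ} {p : Set (A × B)} (hp : p ∈ S r) : L.EF r p := by
  induction r generalizing p with
  | zero => exact h₀ 0 p hp
  | succ r ih =>
    refine ⟨h₀ _ p hp, fun a => ?_, fun b => ?_⟩
    · obtain ⟨b, hb⟩ := forth r p hp a
      exact ⟨b, ih hb⟩
    · obtain ⟨a, ha⟩ := back r p hp b
      exact ⟨a, ih ha⟩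

theorem swap_preimage_insert (a : A) (b : B) (p : Set (A × B)) :
    Prod.swap ⁻¹' (insert (a, b) p) = insert (b, a) (Prod.swap ⁻¹' p) := by
  ext ⟨x, y⟩
  simp [and_comm]

theorem EF.swap {r : ℕ} {p : Set (A × B)} (h : L.EF r p) : L.EF r (Prod.swap ⁻¹' p) := by
  induction r generalizing p with
  | zero => exact PIso.swap h
  | succ r ih =>
    refine ⟨h.1.swap, fun b => ?_, fun a => ?_⟩
    · obtain ⟨a, ha⟩ := h.2.2 b
      exact ⟨a, swap_preimage_insert a b p ▸ ih ha⟩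
    · obtain ⟨b, hb⟩ := h.2.1 a
      exact ⟨b, swap_preimage_insert a b p ▸ ih hb⟩

theorem PIso.pull_equiv {p : Set (A × B)} (h : L.PIso p) (f : A' ≃[L] A) (g : B' ≃[L] B) :
    L.PIso (pull f g p) := by
  refine ⟨fun h₁ h₂ => ?_, fun R x y hx => ?_⟩
  · rw [← f.injective.eq_iff, ← g.injective.eq_iff]
    exact h.eq_iff h₁ h₂
  · rw [← f.map_rel, ← g.map_rel]
    exact h.rel_iff R _ _ hx

theorem EF.pull_equiv {r : ℕ} {p : Set (A × B)} (h : L.EF r p) (f : A' ≃[L] A) (g : B' ≃[L] B) :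
    L.EF r (pull f g p) := by
  induction r generalizing p with
  | zero => exact PIso.pull_equiv h f g
  | succ r ih =>
    refine ⟨h.1.pull_equiv f g, fun a => ?_, fun b => ?_⟩
    · obtain ⟨b, hb⟩ := h.2.1 (f a)
      refine ⟨g.symm b, (ih hb).mono ?_⟩
      rintro z (rfl | hz)
      · simp
      · exact Or.inr hz
    · obtain ⟨a, ha⟩ := h.2.2 (g b)
      refine ⟨f.symm a, (ih ha).mono ?_⟩
      rintro z (rfl | hz)
      · simp
      · exact Or.inr hz

theorem PIsoPos.pull_equiv_symm {p : Set (A' × B')} (h : L.PIsoPos p) (f : A' ≃[L] A)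
    (g : B' ≃[L] B) : L.PIsoPos (pull f.symm g.symm p) := by
  refine ⟨fun h₁ h₂ => ?_, fun R x y hx => ?_⟩
  · rw [← f.symm.injective.eq_iff, ← g.symm.injective.eq_iff]
    exact h.eq_iff h₁ h₂
  · rw [← f.symm.map_rel, ← g.symm.map_rel]
    exact h.rel_iff R _ _ hx

/-- A winning position for `r` rounds does not distinguish formulas of quantifier rank `r`. -/
theorem EF.realize_iff [L.IsRelational] {α : Type} {k : ℕ} (φ : L.BoundedFormula α k) {r : ℕ}
    {p : Set (A × B)} (h : L.EF r p) (hφ : quantifierRank φ ≤ r) {v : α → A} {w : α → B}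
    {xs : Fin k → A} {ys : Fin k → B} (hv : ∀ i, (v i, w i) ∈ p) (hx : ∀ i, (xs i, ys i) ∈ p) :
    φ.Realize v xs ↔ φ.Realize w ys := by
  have ht : ∀ {m : ℕ} {p : Set (A × B)} {xs : Fin m → A} {ys : Fin m → B},
      (∀ i, (v i, w i) ∈ p) → (∀ i, (xs i, ys i) ∈ p) → ∀ t : L.Term (α ⊕ Fin m),
      (t.realize (Sum.elim v xs), t.realize (Sum.elim w ys)) ∈ p := by
    intro m p xs ys hv hx t
    cases t with
    | var i => cases i with
      | inl i => exact hv i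
      | inr i => exact hx i
    | func F _ => exact isEmptyElim F
  induction φ generalizing r p with
  | falsum => rfl
  | equal t s => exact h.pIso.eq_iff (ht hv hx t) (ht hv hx s)
  | rel R ts => exact h.pIso.rel_iff R _ _ fun i => ht hv hx (ts i)
  | imp φ ψ ih₁ ih₂ =>
    simp only [quantifierRank, max_le_iff] at hφ
    exact imp_congr (ih₁ h hφ.1 hv hx) (ih₂ h hφ.2 hv hx)
  | all φ ih =>
    obtain ⟨r, rfl⟩ : ∃ s, r = s + 1 := ⟨r - 1, by simp only [quantifierRank] at hφ; omega⟩
    have hφ' : quantifierRank φ ≤ r := by simpa [quantifierRank] using hφ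
    have key : ∀ {a b}, L.EF r (insert (a, b) p) →
        (φ.Realize v (Fin.snoc xs a) ↔ φ.Realize w (Fin.snoc ys b)) := by
      intro a b hab
      refine ih hab hφ' (fun i => Or.inr (hv i)) fun i => ?_
      induction i using Fin.lastCases with
      | last => simp
      | cast i => simpa using Or.inr (hx i)
    simp only [BoundedFormula.realize_all]
    constructor
    · intro H b
      obtain ⟨a, ha⟩ := h.2.2 b
      exact (key ha).1 (H a)
    · intro H a
      obtain ⟨b, hb⟩ := h.2.1 a
      exact (key hb).2 (H b)

end

/-! ### Definability by quantifier-free formulas -/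

theorem exists_isQF_and {α : Type} {n : ℕ} {D : Type} [Finite D] (f : D → L.BoundedFormula α n)
    (hf : ∀ d, (f d).IsQF) :
    ∃ ψ : L.BoundedFormula α n, ψ.IsQF ∧ ∀ (M : Type u) [L.Structure M] (v : α → M) (xs : Fin n → M),
      ψ.Realize v xs ↔ ∀ d, (f d).Realize v xs := by
  have hl : ∀ l : List D, ∃ ψ : L.BoundedFormula α n, ψ.IsQF ∧
      ∀ (M : Type u) [L.Structure M] (v : α → M) (xs : Fin n → M),
        ψ.Realize v xs ↔ ∀ d ∈ l, (f d).Realize v xs := by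
    intro l
    induction l with
    | nil => exact ⟨⊤, BoundedFormula.IsQF.top, by simp⟩
    | cons d l ih =>
      obtain ⟨ψ, hψ, H⟩ := ih
      exact ⟨f d ⊓ ψ, (hf d).inf hψ, fun M _ v xs => by simp [H]⟩
  have := Fintype.ofFinite D
  obtain ⟨ψ, hψ, H⟩ := hl Finset.univ.toList
  exact ⟨ψ, hψ, fun M _ v xs => by simp [H]⟩

/-- The formulas that say which of finitely many quantifier-free formulas hold are
quantifier-free. -/
theorem exists_isQF_boolean {α : Type} {n : ℕ} {D : Type} [Finite D] (f : D → L.BoundedFormula α n)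
    (hf : ∀ d, (f d).IsQF) (S : Set (D → Prop)) :
    ∃ ψ : L.BoundedFormula α n, ψ.IsQF ∧ ∀ (M : Type u) [L.Structure M] (v : α → M) (xs : Fin n → M),
      ψ.Realize v xs ↔ (fun d => (f d).Realize v xs) ∈ S := by
  classical
  have h₁ : ∀ T : D → Prop, ∃ ψ : L.BoundedFormula α n, ψ.IsQF ∧
      ∀ (M : Type u) [L.Structure M] (v : α → M) (xs : Fin n → M),
        ψ.Realize v xs ↔ (fun d => (f d).Realize v xs) = T := by
    intro T
    obtain ⟨ψ, hψ, H⟩ := exists_isQF_and (fun d => if T d then f d else (f d).not) (by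
      intro d
      split_ifs
      exacts [hf d, (hf d).not])
    refine ⟨ψ, hψ, fun M _ v xs => (H M v xs).trans ?_⟩
    rw [funext_iff]
    refine forall_congr' fun d => ?_
    by_cases h : T d <;> simp [h]
  choose g hg H using h₁
  -- There are finitely many truth patterns on `D`; `ψ` excludes each one outside `S`.
  obtain ⟨ψ, hψ, H'⟩ := exists_isQF_and (fun T : {T // T ∉ S} => (g T.1).not) (fun T => (hg T.1).not)
  refine ⟨ψ, hψ, fun M _ v xs => (H' M v xs).trans ?_⟩
  simp only [BoundedFormula.realize_not, H]
  constructor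
  · intro h
    by_contra hS
    exact h ⟨_, hS⟩ rfl
  · intro h T hT
    exact T.2 (hT ▸ h)

/-- A property of tuples that is invariant under partial isomorphisms is definable by a
quantifier-free formula, if the vocabulary is finite and relational. -/
theorem exists_isQF_of_invariant [L.IsRelational] [Finite (Σ k, L.Relations k)] {m : ℕ}
    (K : Set (Bundled.{u} L.Structure)) (X : (A : Bundled.{u} L.Structure) → (Fin m → A) → Prop)
    (hX : ∀ A ∈ K, ∀ B ∈ K, ∀ (a : Fin m → A) (b : Fin m → B),
      L.PIso (Set.range fun i => (a i, b i)) → X A a → X B b) :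
    ∃ ψ : L.Formula (Fin m), ψ.IsQF ∧ ∀ A ∈ K, ∀ a : Fin m → A, ψ.Realize a ↔ X A a := by
  let D := (Fin m × Fin m) ⊕ Σ R : (Σ k, L.Relations k), Fin R.1 → Fin m
  let f : D → L.Formula (Fin m) := fun d => match d with
    | .inl (i, j) => Term.equal (Term.var i) (Term.var j)
    | .inr ⟨R, x⟩ => R.2.formula fun i => Term.var (x i)
  have hf : ∀ d, (f d).IsQF := by
    rintro (⟨i, j⟩ | ⟨R, x⟩)
    · exact (BoundedFormula.IsAtomic.equal _ _).isQF
    · exact (BoundedFormula.IsAtomic.rel _ _).isQF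
  let ty : (A : Bundled.{u} L.Structure) → (Fin m → A) → D → Prop := fun A a d => (f d).Realize a
  -- `ψ` says that the atomic type of the tuple is realised in `K` by some tuple with property `X`.
  -- Two tuples of equal atomic type are related by a partial isomorphism, so `hX` transfers `X`
  -- from that tuple.
  obtain ⟨ψ, hψ, H⟩ := exists_isQF_boolean.{u} f hf {T | ∃ A ∈ K, ∃ a : Fin m → A, X A a ∧ ty A a = T}
  refine ⟨ψ, hψ, fun A hA a => (H A a default).trans ⟨?_, fun h => ⟨A, hA, a, h, rfl⟩⟩⟩
  rintro ⟨B, hB, b, hb, hT⟩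
  refine hX B hB A hA b a ⟨?_, ?_⟩ hb
  · rintro _ _ _ _ ⟨i, hi⟩ ⟨j, hj⟩
    obtain ⟨rfl, rfl⟩ := Prod.mk.inj hi
    obtain ⟨rfl, rfl⟩ := Prod.mk.inj hj
    exact iff_of_eq (congrFun hT (.inl (i, j)))
  · intro k R x y hxy
    choose t ht using hxy
    have hx : x = b ∘ t := funext fun i => (congrArg Prod.fst (ht i)).symm
    have hy : y = a ∘ t := funext fun i => (congrArg Prod.snd (ht i)).symm
    subst hx hy
    exact iff_of_eq (congrFun hT (.inr ⟨⟨k, R⟩, t⟩))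

end FirstOrder.Language

/-! ### Presentations of structures inside other structures. -/

namespace MultisetType

open FirstOrder.Language FirstOrder.Language.Structure

/-- A relation between structures `A`, structures `B` and functions that embed the universe of `B`
into that of `A`: the structure `B` is presented inside `A`. -/
abbrev Pres (L L' : FirstOrder.Language.{0, 0}) : Type (u + 1) :=
  (A : Bundled.{u} L.Structure) → (B : Bundled.{u} L'.Structure) → (B → A) → Prop

/-- The structures in `K` present structures in `K'`. -/
structure IsPres {L L' : FirstOrder.Language.{0, 0}} (K : Set (Bundled.{u} L.Structure))
    (K' : Set (Bundled.{u} L'.Structure)) (P : Pres.{u} L L') : Prop where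
  mem_left : ∀ {A B e}, P A B e → A ∈ K
  mem_right : ∀ {A B e}, P A B e → B ∈ K'
  injective : ∀ {A B e}, P A B e → e.Injective
  total : ∀ A ∈ K, ∃ B e, P A B e

/-- A presentation such that positions that are partial isomorphisms, possibly up to nullary
relations, of the presenting structures are winning in the presented structures, as long as the
number of pairs and the number of rounds add up to at most `N`. -/
structure IsPosPres {L L' : FirstOrder.Language.{0, 0}} (N : ℕ) (K : Set (Bundled.{u} L.Structure))
    (K' : Set (Bundled.{u} L'.Structure)) (P : Pres.{u} L L') : Prop extends IsPres K K' P where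
  range_iff : ∀ {A B e A' B' e'}, P A B e → P A' B' e' → ∀ {p : Set (A × A')}, L.PIsoPos p →
    ∀ {a a'}, (a, a') ∈ p → (a ∈ Set.range e ↔ a' ∈ Set.range e')
  ef : ∀ {A B e A' B' e'}, P A B e → P A' B' e' → ∀ {p : Set (A × A')}, L.PIsoPos p →
    ∀ {r : ℕ}, p.encard + r ≤ N → L'.EF r (pull e e' p)

/-- The same with partial isomorphisms that respect nullary relations as well. -/
structure IsFullPres {L L' : FirstOrder.Language.{0, 0}} (N : ℕ) (K : Set (Bundled.{u} L.Structure))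
    (K' : Set (Bundled.{u} L'.Structure)) (P : Pres.{u} L L') : Prop extends IsPres K K' P where
  range_iff : ∀ {A B e A' B' e'}, P A B e → P A' B' e' → ∀ {p : Set (A × A')}, L.PIso p →
    ∀ {a a'}, (a, a') ∈ p → (a ∈ Set.range e ↔ a' ∈ Set.range e')
  ef : ∀ {A B e A' B' e'}, P A B e → P A' B' e' → ∀ {p : Set (A × A')}, L.PIso p →
    ∀ {r : ℕ}, p.encard + r ≤ N → L'.EF r (pull e e' p)

theorem IsPosPres.isFullPres {L L' : FirstOrder.Language.{0, 0}} {N : ℕ}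
    {K : Set (Bundled.{u} L.Structure)} {K' : Set (Bundled.{u} L'.Structure)} {P : Pres.{u} L L'}
    (h : IsPosPres N K K' P) : IsFullPres N K K' P :=
  { h.toIsPres with
    range_iff := fun h₁ h₂ _ hp => h.range_iff h₁ h₂ hp.pos
    ef := fun h₁ h₂ _ hp => h.ef h₁ h₂ hp.pos }

/-! ### Games on pairs -/

section Pair

variable {L₁ L₂ : FirstOrder.Language.{0, 0}} {A A' : Bundled.{u} L₁.Structure}
  {B B' : Bundled.{u} L₂.Structure}

/-- The inclusion of the first factor into a pair. -/
def pairInl (A : Bundled.{u} L₁.Structure) (B : Bundled.{u} L₂.Structure) (a : A) :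
    pairStructure A B := (Sum.inl a : A ⊕ B)

/-- The inclusion of the second factor into a pair. -/
def pairInr (A : Bundled.{u} L₁.Structure) (B : Bundled.{u} L₂.Structure) (b : B) :
    pairStructure A B := (Sum.inr b : A ⊕ B)

theorem pairInl_injective : (pairInl A B).Injective := Sum.inl_injective

theorem pairInr_injective : (pairInr A B).Injective := Sum.inr_injective

theorem pairInl_ne_pairInr (a : A) (b : B) : pairInl A B a ≠ pairInr A B b := Sum.inl_ne_inr

theorem pair_cases (z : pairStructure A B) : (∃ a, z = pairInl A B a) ∨ ∃ b, z = pairInr A B b := by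
  rcases (show A ⊕ B from z) with a | b
  exacts [Or.inl ⟨a, rfl⟩, Or.inr ⟨b, rfl⟩]

/-- Both elements of every pair of the position come from the same factor. -/
def SameSide (p : Set (pairStructure A B × pairStructure A' B')) : Prop :=
  ∀ z z', (z, z') ∈ p → ((∃ a, z = pairInl A B a) ↔ ∃ a, z' = pairInl A' B' a)

/-- The name `side` is unary, so it is respected even when nullary names are ignored. -/
theorem SameSide.of_pIsoPos {p : Set (pairStructure A B × pairStructure A' B')}
    (h : (prodVoc L₁ L₂).PIsoPos p) : SameSide p := fun z z' hz =>
  h.rel_iff (k := 0) ProdRel.side (fun _ => z) (fun _ => z') fun _ => hz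

theorem relMap_pair_inl {k : ℕ} (R : L₁.Relations k) (x : Fin k → A) :
    RelMap (L := prodVoc L₁ L₂) (M := pairStructure A B) (ProdRel.inl R) (fun i => pairInl A B (x i)) ↔
      RelMap R x := by
  constructor
  · rintro ⟨y, hy, h⟩
    obtain rfl : x = y := funext fun i => Sum.inl_injective (congrFun hy i)
    exact h
  · exact fun h => ⟨x, rfl, h⟩

theorem relMap_pair_inr {k : ℕ} (R : L₂.Relations k) (x : Fin k → B) :
    RelMap (L := prodVoc L₁ L₂) (M := pairStructure A B) (ProdRel.inr R) (fun i => pairInr A B (x i)) ↔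
      RelMap R x := by
  constructor
  · rintro ⟨y, hy, h⟩
    obtain rfl : x = y := funext fun i => Sum.inr_injective (congrFun hy i)
    exact h
  · exact fun h => ⟨x, rfl, h⟩

theorem pIsoPos_pull_pairInl {p : Set (pairStructure A B × pairStructure A' B')}
    (h : (prodVoc L₁ L₂).PIsoPos p) : L₁.PIsoPos (pull (pairInl A B) (pairInl A' B') p) := by
  refine ⟨fun h₁ h₂ => ?_, fun R x y hxy => ?_⟩
  · rw [← (pairInl_injective (A := A) (B := B)).eq_iff,
      ← (pairInl_injective (A := A') (B := B')).eq_iff]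
    exact h.eq_iff h₁ h₂
  · rw [← relMap_pair_inl (B := B), ← relMap_pair_inl (B := B')]
    exact h.rel_iff (ProdRel.inl R) _ _ hxy

theorem pIsoPos_pull_pairInr {p : Set (pairStructure A B × pairStructure A' B')}
    (h : (prodVoc L₁ L₂).PIsoPos p) : L₂.PIsoPos (pull (pairInr A B) (pairInr A' B') p) := by
  refine ⟨fun h₁ h₂ => ?_, fun R x y hxy => ?_⟩
  · rw [← (pairInr_injective (A := A) (B := B)).eq_iff,
      ← (pairInr_injective (A := A') (B := B')).eq_iff]
    exact h.eq_iff h₁ h₂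
  · rw [← relMap_pair_inr (A := A), ← relMap_pair_inr (A := A')]
    exact h.rel_iff (ProdRel.inr R) _ _ hxy

theorem SameSide.left {p : Set (pairStructure A B × pairStructure A' B')} (h : SameSide p) {a : A}
    {z' : pairStructure A' B'} (hz : (pairInl A B a, z') ∈ p) : ∃ a', z' = pairInl A' B' a' :=
  (h _ _ hz).1 ⟨a, rfl⟩

theorem SameSide.left' {p : Set (pairStructure A B × pairStructure A' B')} (h : SameSide p) {a : A'}
    {z : pairStructure A B} (hz : (z, pairInl A' B' a) ∈ p) : ∃ a, z = pairInl A B a :=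
  (h _ _ hz).2 ⟨a, rfl⟩

theorem SameSide.right {p : Set (pairStructure A B × pairStructure A' B')} (h : SameSide p) {b : B}
    {z' : pairStructure A' B'} (hz : (pairInr A B b, z') ∈ p) : ∃ b', z' = pairInr A' B' b' := by
  rcases pair_cases z' with ⟨a, rfl⟩ | h'
  · obtain ⟨a, ha⟩ := h.left' hz
    exact (pairInl_ne_pairInr _ _ ha.symm).elim
  · exact h'

theorem SameSide.right' {p : Set (pairStructure A B × pairStructure A' B')} (h : SameSide p) {b : B'}
    {z : pairStructure A B} (hz : (z, pairInr A' B' b) ∈ p) : ∃ b, z = pairInr A B b := by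
  rcases pair_cases z with ⟨a, rfl⟩ | h'
  · obtain ⟨a, ha⟩ := h.left hz
    exact (pairInl_ne_pairInr _ _ ha.symm).elim
  · exact h'

/-- A relation of one factor holds only of tuples inside that factor. As the position keeps sides,
such a tuple is matched with a tuple of the same factor, where the hypothesis on that factor
applies. Nullary names are covered because the hypotheses on the factors respect them. -/
theorem pIso_pair {p : Set (pairStructure A B × pairStructure A' B')} (h : SameSide p)
    (h₁ : L₁.PIso (pull (pairInl A B) (pairInl A' B') p))
    (h₂ : L₂.PIso (pull (pairInr A B) (pairInr A' B') p)) : (prodVoc L₁ L₂).PIso p := by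
  refine ⟨?_, ?_⟩
  · intro z z' w w' hz hw
    rcases pair_cases z with ⟨a, rfl⟩ | ⟨b, rfl⟩
    · obtain ⟨a', rfl⟩ := h.left hz
      rcases pair_cases w with ⟨c, rfl⟩ | ⟨d, rfl⟩
      · obtain ⟨c', rfl⟩ := h.left hw
        rw [pairInl_injective.eq_iff, pairInl_injective.eq_iff]
        exact h₁.eq_iff hz hw
      · obtain ⟨d', rfl⟩ := h.right hw
        exact iff_of_false (pairInl_ne_pairInr _ _) (pairInl_ne_pairInr _ _)
    · obtain ⟨b', rfl⟩ := h.right hz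
      rcases pair_cases w with ⟨c, rfl⟩ | ⟨d, rfl⟩
      · obtain ⟨c', rfl⟩ := h.left hw
        exact iff_of_false (pairInl_ne_pairInr _ _).symm (pairInl_ne_pairInr _ _).symm
      · obtain ⟨d', rfl⟩ := h.right hw
        rw [pairInr_injective.eq_iff, pairInr_injective.eq_iff]
        exact h₂.eq_iff hz hw
  · intro k R x y hxy
    cases R with
    | inl R =>
      constructor
      · rintro ⟨x, rfl, hx⟩
        choose y' hy using fun i => h.left (hxy i)
        obtain rfl := funext hy
        exact (relMap_pair_inl R y').2 ((h₁.rel_iff R x y' hxy).1 hx)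
      · rintro ⟨y, rfl, hy⟩
        choose x' hx using fun i => h.left' (hxy i)
        obtain rfl := funext hx
        exact (relMap_pair_inl R x').2 ((h₁.rel_iff R x' y hxy).2 hy)
    | inr R =>
      constructor
      · rintro ⟨x, rfl, hx⟩
        choose y' hy using fun i => h.right (hxy i)
        obtain rfl := funext hy
        exact (relMap_pair_inr R y').2 ((h₂.rel_iff R x y' hxy).1 hx)
      · rintro ⟨y, rfl, hy⟩
        choose x' hx using fun i => h.right' (hxy i)
        obtain rfl := funext hx
        exact (relMap_pair_inr R x').2 ((h₂.rel_iff R x' y hxy).2 hy)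
    | side => exact h _ _ (hxy 0)

theorem SameSide.insert_left {p : Set (pairStructure A B × pairStructure A' B')} (h : SameSide p)
    (a : A) (a' : A') : SameSide (insert (pairInl A B a, pairInl A' B' a') p) := by
  rintro z z' (hz | hz)
  · obtain ⟨rfl, rfl⟩ := Prod.mk.inj hz
    exact iff_of_true ⟨_, rfl⟩ ⟨_, rfl⟩
  · exact h _ _ hz

theorem SameSide.insert_right {p : Set (pairStructure A B × pairStructure A' B')} (h : SameSide p)
    (b : B) (b' : B') : SameSide (insert (pairInr A B b, pairInr A' B' b') p) := by
  rintro z z' (hz | hz)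
  · obtain ⟨rfl, rfl⟩ := Prod.mk.inj hz
    exact iff_of_false (fun ⟨_, h⟩ => pairInl_ne_pairInr _ _ h.symm)
      (fun ⟨_, h⟩ => pairInl_ne_pairInr _ _ h.symm)
  · exact h _ _ hz

/-- The game on pairs decomposes into the games on the factors. -/
theorem ef_pair {r : ℕ} {p : Set (pairStructure A B × pairStructure A' B')} (h : SameSide p)
    (h₁ : L₁.EF r (pull (pairInl A B) (pairInl A' B') p))
    (h₂ : L₂.EF r (pull (pairInr A B) (pairInr A' B') p)) : (prodVoc L₁ L₂).EF r p := by
  -- A move in the first factor is answered there; the game on the second factor keeps its position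
  -- and merely gives up a round.
  have hl : ∀ {r : ℕ} {p : Set (pairStructure A B × pairStructure A' B')} {a a'}, SameSide p →
      L₁.EF r (insert (a, a') (pull (pairInl A B) (pairInl A' B') p)) →
      L₂.EF (r + 1) (pull (pairInr A B) (pairInr A' B') p) →
      insert (pairInl A B a, pairInl A' B' a') p ∈ {p | SameSide p ∧
        L₁.EF r (pull (pairInl A B) (pairInl A' B') p) ∧
        L₂.EF r (pull (pairInr A B) (pairInr A' B') p)} := by
    intro r p a a' h h₁ h₂
    refine ⟨h.insert_left a a', h₁.mono ?_, h₂.of_succ.mono ?_⟩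
    · rintro ⟨z, z'⟩ (hz | hz)
      · obtain ⟨h₁, h₂⟩ := Prod.mk.inj hz
        exact Or.inl (Prod.ext (pairInl_injective h₁) (pairInl_injective h₂))
      · exact Or.inr hz
    · rintro ⟨z, z'⟩ (hz | hz)
      · exact (pairInl_ne_pairInr _ _ (Prod.mk.inj hz).1.symm).elim
      · exact hz
  have hr : ∀ {r : ℕ} {p : Set (pairStructure A B × pairStructure A' B')} {b b'}, SameSide p →
      L₁.EF (r + 1) (pull (pairInl A B) (pairInl A' B') p) →
      L₂.EF r (insert (b, b') (pull (pairInr A B) (pairInr A' B') p)) →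
      insert (pairInr A B b, pairInr A' B' b') p ∈ {p | SameSide p ∧
        L₁.EF r (pull (pairInl A B) (pairInl A' B') p) ∧
        L₂.EF r (pull (pairInr A B) (pairInr A' B') p)} := by
    intro r p b b' h h₁ h₂
    refine ⟨h.insert_right b b', h₁.of_succ.mono ?_, h₂.mono ?_⟩
    · rintro ⟨z, z'⟩ (hz | hz)
      · exact (pairInl_ne_pairInr _ _ (Prod.mk.inj hz).1).elim
      · exact hz
    · rintro ⟨z, z'⟩ (hz | hz)
      · obtain ⟨h₁, h₂⟩ := Prod.mk.inj hz
        exact Or.inl (Prod.ext (pairInr_injective h₁) (pairInr_injective h₂))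
      · exact Or.inr hz
  refine EF.of_backForth (fun r => {p | SameSide p ∧ L₁.EF r (pull (pairInl A B) (pairInl A' B') p) ∧
    L₂.EF r (pull (pairInr A B) (pairInr A' B') p)}) ?_ ?_ ?_ ⟨h, h₁, h₂⟩
  · rintro r p ⟨h, h₁, h₂⟩
    exact pIso_pair h h₁.pIso h₂.pIso
  · rintro r p ⟨h, h₁, h₂⟩ z
    rcases pair_cases z with ⟨a, rfl⟩ | ⟨b, rfl⟩
    · obtain ⟨a', ha⟩ := h₁.2.1 a
      exact ⟨_, hl h ha h₂⟩
    · obtain ⟨b', hb⟩ := h₂.2.1 b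
      exact ⟨_, hr h h₁ hb⟩
  · rintro r p ⟨h, h₁, h₂⟩ z
    rcases pair_cases z with ⟨a, rfl⟩ | ⟨b, rfl⟩
    · obtain ⟨a', ha⟩ := h₁.2.2 a
      exact ⟨_, hl h ha h₂⟩
    · obtain ⟨b', hb⟩ := h₂.2.2 b
      exact ⟨_, hr h h₁ hb⟩

/-- The function between pairs that is given by functions between the factors. -/
def pairMap {L₁' L₂' : FirstOrder.Language.{0, 0}} {C : Bundled.{u} L₁'.Structure}
    {D : Bundled.{u} L₂'.Structure} (f : A → C) (g : B → D) :
    pairStructure A B → pairStructure C D := Sum.map f g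

section PairMap

variable {L₁' L₂' : FirstOrder.Language.{0, 0}} {C : Bundled.{u} L₁'.Structure}
  {D : Bundled.{u} L₂'.Structure} {f : C → A} {g : D → B}

theorem pairInl_mem_range (a : A) :
    pairInl A B a ∈ Set.range (pairMap f g) ↔ a ∈ Set.range f := by
  constructor
  · rintro ⟨b | b, hb⟩
    · exact ⟨b, Sum.inl_injective hb⟩
    · exact (Sum.inr_ne_inl hb).elim
  · rintro ⟨b, rfl⟩
    exact ⟨Sum.inl b, rfl⟩

theorem pairInr_mem_range (b : B) :
    pairInr A B b ∈ Set.range (pairMap f g) ↔ b ∈ Set.range g := by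
  constructor
  · rintro ⟨c | c, hc⟩
    · exact (Sum.inl_ne_inr hc).elim
    · exact ⟨c, Sum.inr_injective hc⟩
  · rintro ⟨c, rfl⟩
    exact ⟨Sum.inr c, rfl⟩

theorem mem_range_of_pairMap {M : Bundled.{u} (prodVoc L₁ L₂).Structure}
    {M' : Bundled.{u} (prodVoc L₁' L₂').Structure} {e : M' → M}
    (i : M ≃[prodVoc L₁ L₂] pairStructure A B) (j : M' ≃[prodVoc L₁' L₂'] pairStructure C D)
    (he : ∀ b, e b = i.symm (pairMap f g (j b))) (z : pairStructure A B) :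
    i.symm z ∈ Set.range e ↔ z ∈ Set.range (pairMap f g) := by
  constructor
  · rintro ⟨b, hb⟩
    rw [he] at hb
    exact ⟨_, i.symm.injective hb⟩
  · rintro ⟨b, rfl⟩
    obtain ⟨c, rfl⟩ := j.surjective b
    exact ⟨c, he c⟩

end PairMap

/-- Presentations of the factors give a presentation of the pair. -/
def prodPres {L₁' L₂' : FirstOrder.Language.{0, 0}} (P₁ : Pres.{u} L₁ L₁') (P₂ : Pres.{u} L₂ L₂') :
    Pres.{u} (prodVoc L₁ L₂) (prodVoc L₁' L₂') := fun A B e =>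
  ∃ A₁ B₁ e₁ A₂ B₂ e₂, P₁ A₁ B₁ e₁ ∧ P₂ A₂ B₂ e₂ ∧
    ∃ (g : A ≃[prodVoc L₁ L₂] pairStructure A₁ A₂) (h : B ≃[prodVoc L₁' L₂'] pairStructure B₁ B₂),
      ∀ b, e b = g.symm (pairMap e₁ e₂ (h b))

/-- A partial isomorphism of pairs restricts to one on each factor with no more pairs, so each
factor is winning with the same budget, and `ef_pair` combines the two games. -/
theorem IsPosPres.prod {L₁' L₂' : FirstOrder.Language.{0, 0}} {N : ℕ}
    {K₁ : Set (Bundled.{u} L₁.Structure)} {K₂ : Set (Bundled.{u} L₂.Structure)}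
    {K₁' : Set (Bundled.{u} L₁'.Structure)} {K₂' : Set (Bundled.{u} L₂'.Structure)}
    {P₁ : Pres.{u} L₁ L₁'} {P₂ : Pres.{u} L₂ L₂'}
    (h₁ : IsPosPres N K₁ K₁' P₁) (h₂ : IsPosPres N K₂ K₂' P₂) :
    IsPosPres N (prodClass K₁ K₂) (prodClass K₁' K₂') (prodPres P₁ P₂) where
  mem_left := by
    rintro A B e ⟨A₁, B₁, e₁, A₂, B₂, e₂, H₁, H₂, g, h, -⟩
    exact ⟨A₁, h₁.mem_left H₁, A₂, h₂.mem_left H₂, ⟨g⟩⟩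
  mem_right := by
    rintro A B e ⟨A₁, B₁, e₁, A₂, B₂, e₂, H₁, H₂, g, h, -⟩
    exact ⟨B₁, h₁.mem_right H₁, B₂, h₂.mem_right H₂, ⟨h⟩⟩
  injective := by
    rintro A B e ⟨A₁, B₁, e₁, A₂, B₂, e₂, H₁, H₂, g, h, he⟩ b b' hb
    rw [he, he] at hb
    exact h.injective ((Sum.map_injective.2 ⟨h₁.injective H₁, h₂.injective H₂⟩)
      (g.symm.injective hb))
  total := by
    rintro A ⟨A₁, hA₁, A₂, hA₂, ⟨g⟩⟩
    obtain ⟨B₁, e₁, H₁⟩ := h₁.total A₁ hA₁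
    obtain ⟨B₂, e₂, H₂⟩ := h₂.total A₂ hA₂
    exact ⟨pairStructure B₁ B₂, fun b => g.symm (pairMap e₁ e₂ b), A₁, B₁, e₁, A₂, B₂, e₂, H₁, H₂, g,
      Language.Equiv.refl _ _, fun _ => rfl⟩
  range_iff := by
    rintro A B e A' B' e' ⟨A₁, B₁, e₁, A₂, B₂, e₂, H₁, H₂, g, h, he⟩
      ⟨A₁', B₁', e₁', A₂', B₂', e₂', H₁', H₂', g', h', he'⟩ p hp a a' ha
    have hq := hp.pull_equiv_symm g g'
    have hs := SameSide.of_pIsoPos hq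
    obtain ⟨z, rfl⟩ := g.symm.surjective a
    obtain ⟨z', rfl⟩ := g'.symm.surjective a'
    rw [mem_range_of_pairMap g h he, mem_range_of_pairMap g' h' he']
    have ha' : (z, z') ∈ pull g.symm g'.symm p := ha
    rcases pair_cases z with ⟨a, rfl⟩ | ⟨b, rfl⟩
    · obtain ⟨a', rfl⟩ := hs.left ha'
      rw [pairInl_mem_range, pairInl_mem_range]
      exact h₁.range_iff H₁ H₁' (pIsoPos_pull_pairInl hq) ha'
    · obtain ⟨b', rfl⟩ := hs.right ha'
      rw [pairInr_mem_range, pairInr_mem_range]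
      exact h₂.range_iff H₂ H₂' (pIsoPos_pull_pairInr hq) ha'
  ef := by
    rintro A B e A' B' e' ⟨A₁, B₁, e₁, A₂, B₂, e₂, H₁, H₂, g, h, he⟩
      ⟨A₁', B₁', e₁', A₂', B₂', e₂', H₁', H₂', g', h', he'⟩ p hp r hr
    have hq := hp.pull_equiv_symm g g'
    have hs := SameSide.of_pIsoPos hq
    have hqr : (pull g.symm g'.symm p).encard + r ≤ N :=
      (add_le_add_left (encard_pull_le g.symm.injective g'.symm.injective) _).trans hr
    have hE : (prodVoc L₁' L₂').EF r (pull (pairMap e₁ e₂) (pairMap e₁' e₂')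
        (pull g.symm g'.symm p)) := by
      refine ef_pair ?_ ?_ ?_
      · rintro (b | b) (b' | b') hb
        · exact iff_of_true ⟨b, rfl⟩ ⟨b', rfl⟩
        · obtain ⟨a, ha⟩ := hs.left (a := e₁ b) hb
          exact (Sum.inr_ne_inl ha).elim
        · obtain ⟨a, ha⟩ := hs.right (b := e₂ b) hb
          exact (Sum.inl_ne_inr ha).elim
        · exact iff_of_false (fun ⟨_, h⟩ => Sum.inr_ne_inl h) (fun ⟨_, h⟩ => Sum.inr_ne_inl h)
      · exact h₁.ef H₁ H₁' (pIsoPos_pull_pairInl hq) ((add_le_add_left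
          (encard_pull_le pairInl_injective pairInl_injective) _).trans hqr)
      · exact h₂.ef H₂ H₂' (pIsoPos_pull_pairInr hq) ((add_le_add_left
          (encard_pull_le pairInr_injective pairInr_injective) _).trans hqr)
    refine (hE.pull_equiv h h').mono fun z hz => ?_
    simpa [he, he'] using hz

end Pair

/-! ### Games on coproducts -/

section Coproduct

variable {L₁ L₂ : FirstOrder.Language.{0, 0}}

theorem pIso_leftStructure {A A' : Bundled.{u} L₁.Structure} {p : Set (A × A')} (h : L₁.PIso p) :
    (sumVoc L₁ L₂).PIso (A := leftStructure L₂ A) (B := leftStructure L₂ A') p := by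
  refine ⟨h.eq_iff, fun R x y hxy => ?_⟩
  cases R with
  | inl R => exact h.rel_iff R x y hxy
  | inr R => exact Iff.rfl
  | isLeft => exact Iff.rfl

theorem pIso_rightStructure {A A' : Bundled.{u} L₂.Structure} {p : Set (A × A')} (h : L₂.PIso p) :
    (sumVoc L₁ L₂).PIso (A := rightStructure L₁ A) (B := rightStructure L₁ A') p := by
  refine ⟨h.eq_iff, fun R x y hxy => ?_⟩
  cases R with
  | inl R => exact Iff.rfl
  | inr R => exact h.rel_iff R x y hxy
  | isLeft => exact Iff.rfl

/-- The universes are unchanged and the added names have the same constant interpretation on both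
sides, so the same strategy wins. -/
theorem ef_leftStructure {A A' : Bundled.{u} L₁.Structure} {r : ℕ} {p : Set (A × A')}
    (h : L₁.EF r p) :
    (sumVoc L₁ L₂).EF (A := leftStructure L₂ A) (B := leftStructure L₂ A') r p :=
  EF.of_backForth (A := leftStructure L₂ A) (B := leftStructure L₂ A')
    (fun r => {p | L₁.EF (A := A) (B := A') r p})
    (fun _ _ h => pIso_leftStructure (EF.pIso h)) (fun _ _ h => h.2.1) (fun _ _ h => h.2.2) h

theorem ef_rightStructure {A A' : Bundled.{u} L₂.Structure} {r : ℕ} {p : Set (A × A')}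
    (h : L₂.EF r p) :
    (sumVoc L₁ L₂).EF (A := rightStructure L₁ A) (B := rightStructure L₁ A') r p :=
  EF.of_backForth (A := rightStructure L₁ A) (B := rightStructure L₁ A')
    (fun r => {p | L₂.EF (A := A) (B := A') r p})
    (fun _ _ h => pIso_rightStructure (EF.pIso h)) (fun _ _ h => h.2.1) (fun _ _ h => h.2.2) h

theorem PIso.of_leftStructure {A A' : Bundled.{u} L₁.Structure}
    {p : Set (leftStructure L₂ A × leftStructure L₂ A')} (h : (sumVoc L₁ L₂).PIso p) :
    L₁.PIso (A := A) (B := A') p :=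
  ⟨h.eq_iff, fun R => h.rel_iff (SumRel.inl R)⟩

theorem PIso.of_rightStructure {A A' : Bundled.{u} L₂.Structure}
    {p : Set (rightStructure L₁ A × rightStructure L₁ A')} (h : (sumVoc L₁ L₂).PIso p) :
    L₂.PIso (A := A) (B := A') p :=
  ⟨h.eq_iff, fun R => h.rel_iff (SumRel.inr R)⟩

end Coproduct

end MultisetType

namespace MultisetType

open FirstOrder.Language FirstOrder.Language.Structure

/-! ### Basic facts about multiset types -/

theorem mem_sumClass_of_equiv {L₁ L₂ : FirstOrder.Language.{0, 0}}
    {K₁ : Set (Bundled.{u} L₁.Structure)} {K₂ : Set (Bundled.{u} L₂.Structure)}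
    {A B : Bundled.{u} (sumVoc L₁ L₂).Structure} (hA : A ∈ sumClass K₁ K₂)
    (g : B ≃[sumVoc L₁ L₂] A) : B ∈ sumClass K₁ K₂ := by
  rcases hA with ⟨C, hC, ⟨h⟩⟩ | ⟨C, hC, ⟨h⟩⟩
  · exact Or.inl ⟨C, hC, ⟨h.comp g⟩⟩
  · exact Or.inr ⟨C, hC, ⟨h.comp g⟩⟩

theorem mem_prodClass_of_equiv {L₁ L₂ : FirstOrder.Language.{0, 0}}
    {K₁ : Set (Bundled.{u} L₁.Structure)} {K₂ : Set (Bundled.{u} L₂.Structure)}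
    {A B : Bundled.{u} (prodVoc L₁ L₂).Structure} (hA : A ∈ prodClass K₁ K₂)
    (g : B ≃[prodVoc L₁ L₂] A) : B ∈ prodClass K₁ K₂ := by
  obtain ⟨C, hC, D, hD, ⟨h⟩⟩ := hA
  exact ⟨C, hC, D, hD, ⟨h.comp g⟩⟩

theorem mem_multisetClass_of_equiv {L : FirstOrder.Language.{0, 0}}
    {K : Set (Bundled.{u} L.Structure)} {A B : Bundled.{u} (multisetVoc L).Structure}
    (hA : A ∈ multisetClass K) (g : B ≃[multisetVoc L] A) : B ∈ multisetClass K := by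
  obtain ⟨m, C, hC, ⟨h⟩⟩ := hA
  exact ⟨m, C, hC, ⟨h.comp g⟩⟩

theorem mem_structures_of_equiv {σ : MultisetType} {A B : Bundled.{u} σ.voc.Structure}
    (hA : A ∈ σ.structures) (g : B ≃[σ.voc] A) : B ∈ σ.structures := by
  cases σ with
  | one => exact (Nat.card_congr g.toEquiv).trans hA
  | sum σ τ => exact mem_sumClass_of_equiv hA g
  | prod σ τ => exact mem_prodClass_of_equiv hA g
  | multiset σ => exact mem_multisetClass_of_equiv hA g

theorem finite_relations : ∀ σ : MultisetType, Finite (Σ k, σ.voc.Relations k)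
  | one => by
    have : IsEmpty (Σ k, one.voc.Relations k) := ⟨fun R => (R.2 : Empty).elim⟩
    infer_instance
  | sum σ τ => by
    have := finite_relations σ
    have := finite_relations τ
    refine Finite.of_surjective
      (fun R : ((Σ k, σ.voc.Relations k) ⊕ (Σ k, τ.voc.Relations k)) ⊕ Unit => match R with
        | .inl (.inl ⟨k, R⟩) => (⟨k, SumRel.inl R⟩ : Σ k, SumRel σ.voc τ.voc k)
        | .inl (.inr ⟨k, R⟩) => ⟨k, SumRel.inr R⟩
        | .inr _ => ⟨0, SumRel.isLeft⟩) ?_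
    rintro ⟨k, R | R | _⟩
    exacts [⟨.inl (.inl ⟨k, R⟩), rfl⟩, ⟨.inl (.inr ⟨k, R⟩), rfl⟩, ⟨.inr (), rfl⟩]
  | prod σ τ => by
    have := finite_relations σ
    have := finite_relations τ
    refine Finite.of_surjective
      (fun R : ((Σ k, σ.voc.Relations k) ⊕ (Σ k, τ.voc.Relations k)) ⊕ Unit => match R with
        | .inl (.inl ⟨k, R⟩) => (⟨k, ProdRel.inl R⟩ : Σ k, ProdRel σ.voc τ.voc k)
        | .inl (.inr ⟨k, R⟩) => ⟨k, ProdRel.inr R⟩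
        | .inr _ => ⟨1, ProdRel.side⟩) ?_
    rintro ⟨k, R | R | _⟩
    exacts [⟨.inl (.inl ⟨k, R⟩), rfl⟩, ⟨.inl (.inr ⟨k, R⟩), rfl⟩, ⟨.inr (), rfl⟩]
  | multiset σ => by
    have := finite_relations σ
    refine Finite.of_surjective
      (fun R : (Σ k, σ.voc.Relations k) ⊕ Unit => match R with
        | .inl ⟨0, R⟩ => (⟨1, MultisetRel.lifted R⟩ : Σ k, MultisetRel σ.voc k)
        | .inl ⟨k + 1, R⟩ => ⟨k + 1, MultisetRel.old R⟩
        | .inr _ => ⟨2, MultisetRel.sim⟩) ?_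
    rintro ⟨k, R | R | _⟩
    exacts [⟨.inl ⟨_, R⟩, rfl⟩, ⟨.inl ⟨0, R⟩, rfl⟩, ⟨.inr (), rfl⟩]

/-! ### Merging two presentations by a coproduct -/

/-- Two presentations of structures of the same kind, merged over the coproduct. -/
def sumPres {L₁ L₂ L' : FirstOrder.Language.{0, 0}} (P₁ : Pres.{u} L₁ L') (P₂ : Pres.{u} L₂ L') :
    Pres.{u} (sumVoc L₁ L₂) L' := fun A B e =>
  (∃ A₁ e₁, P₁ A₁ B e₁ ∧ ∃ g : A ≃[sumVoc L₁ L₂] leftStructure L₂ A₁, ∀ b, e b = g.symm (e₁ b)) ∨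
    ∃ A₂ e₂, P₂ A₂ B e₂ ∧ ∃ g : A ≃[sumVoc L₁ L₂] rightStructure L₁ A₂, ∀ b, e b = g.symm (e₂ b)

/-- The nullary name `isLeft` alone separates the summands. No pair of the position is involved, so
this needs partial isomorphisms that respect nullary names. -/
theorem not_pIso_left_right {L₁ L₂ : FirstOrder.Language.{0, 0}} {A : Bundled.{u} L₁.Structure}
    {B : Bundled.{u} L₂.Structure} {p : Set (leftStructure L₂ A × rightStructure L₁ B)} :
    ¬ (sumVoc L₁ L₂).PIso p := fun h =>
  (h.rel_iff (SumRel.isLeft) Fin.elim0 Fin.elim0 fun i => i.elim0).1 trivial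

theorem _root_.FirstOrder.Language.PIso.pull_symm {L : FirstOrder.Language.{0, 0}}
    {A A' B B' : Type u} [L.Structure A] [L.Structure A'] [L.Structure B] [L.Structure B']
    {p : Set (A × A')} (h : L.PIso p) (g : A ≃[L] B) (g' : A' ≃[L] B') :
    L.PIso (pull g.symm g'.symm p) := h.pull_equiv g.symm g'.symm

theorem mem_range_symm_comp {L : FirstOrder.Language.{0, 0}} {A A₁ B : Type u} [L.Structure A]
    [L.Structure A₁] {e : B → A} {e₁ : B → A₁} (g : A ≃[L] A₁) (he : ∀ b, e b = g.symm (e₁ b))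
    (a : A) : a ∈ Set.range e ↔ g a ∈ Set.range e₁ := by
  constructor
  · rintro ⟨b, rfl⟩
    exact ⟨b, by simp [he]⟩
  · rintro ⟨b, hb⟩
    exact ⟨b, by simp [he, hb]⟩

theorem IsFullPres.sum {L₁ L₂ L' : FirstOrder.Language.{0, 0}} {N : ℕ}
    {K₁ : Set (Bundled.{u} L₁.Structure)} {K₂ : Set (Bundled.{u} L₂.Structure)}
    {K' : Set (Bundled.{u} L'.Structure)} {P₁ : Pres.{u} L₁ L'} {P₂ : Pres.{u} L₂ L'}
    (h₁ : IsFullPres N K₁ K' P₁) (h₂ : IsFullPres N K₂ K' P₂) :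
    IsFullPres N (sumClass K₁ K₂) K' (sumPres P₁ P₂) where
  mem_left := by
    rintro A B e (⟨A₁, e₁, H, g, -⟩ | ⟨A₁, e₁, H, g, -⟩)
    · exact Or.inl ⟨A₁, h₁.mem_left H, ⟨g⟩⟩
    · exact Or.inr ⟨A₁, h₂.mem_left H, ⟨g⟩⟩
  mem_right := by
    rintro A B e (⟨A₁, e₁, H, -⟩ | ⟨A₁, e₁, H, -⟩)
    exacts [h₁.mem_right H, h₂.mem_right H]
  injective := by
    rintro A B e (⟨A₁, e₁, H, g, he⟩ | ⟨A₁, e₁, H, g, he⟩) b b' hb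
    · rw [he, he] at hb
      exact h₁.injective H (g.symm.injective hb)
    · rw [he, he] at hb
      exact h₂.injective H (g.symm.injective hb)
  total := by
    rintro A (⟨A₁, hA, ⟨g⟩⟩ | ⟨A₁, hA, ⟨g⟩⟩)
    · obtain ⟨B, e, H⟩ := h₁.total A₁ hA
      exact ⟨B, fun b => g.symm (e b), Or.inl ⟨A₁, e, H, g, fun _ => rfl⟩⟩
    · obtain ⟨B, e, H⟩ := h₂.total A₁ hA
      exact ⟨B, fun b => g.symm (e b), Or.inr ⟨A₁, e, H, g, fun _ => rfl⟩⟩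
  range_iff := by
    rintro A B e A' B' e' (⟨A₁, e₁, H, g, he⟩ | ⟨A₁, e₁, H, g, he⟩)
      (⟨A₁', e₁', H', g', he'⟩ | ⟨A₁', e₁', H', g', he'⟩) p hp a a' ha
    · rw [mem_range_symm_comp g he, mem_range_symm_comp g' he']
      exact h₁.range_iff H H' (PIso.of_leftStructure (hp.pull_symm g g')) (by
        change (g.symm (g a), g'.symm (g' a')) ∈ p
        simpa using ha)
    · exact (not_pIso_left_right (hp.pull_symm g g')).elim
    · exact (not_pIso_left_right (hp.pull_symm g g').swap).elim
    · rw [mem_range_symm_comp g he, mem_range_symm_comp g' he']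
      exact h₂.range_iff H H' (PIso.of_rightStructure (hp.pull_symm g g')) (by
        change (g.symm (g a), g'.symm (g' a')) ∈ p
        simpa using ha)
  ef := by
    rintro A B e A' B' e' (⟨A₁, e₁, H, g, he⟩ | ⟨A₁, e₁, H, g, he⟩)
      (⟨A₁', e₁', H', g', he'⟩ | ⟨A₁', e₁', H', g', he'⟩) p hp r hr
    · refine (h₁.ef H H' (PIso.of_leftStructure (hp.pull_symm g g'))
        ((add_le_add_left (encard_pull_le g.symm.injective g'.symm.injective) _).trans hr)).mono ?_
      intro z hz
      change (g.symm (e₁ z.1), g'.symm (e₁' z.2)) ∈ p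
      simpa [he, he'] using hz
    · exact (not_pIso_left_right (hp.pull_symm g g')).elim
    · exact (not_pIso_left_right (hp.pull_symm g g').swap).elim
    · refine (h₂.ef H H' (PIso.of_rightStructure (hp.pull_symm g g'))
        ((add_le_add_left (encard_pull_le g.symm.injective g'.symm.injective) _).trans hr)).mono ?_
      intro z hz
      change (g.symm (e₁ z.1), g'.symm (e₁' z.2)) ∈ p
      simpa [he, he'] using hz

/-! ### Finite covers by presentations -/

/-- The structures of `σ` are presented by finitely many multiset types, in each of which partial
isomorphisms up to nullary relations are winning. -/
def HasCover (N : ℕ) (σ : MultisetType) : Prop :=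
  ∃ (I : Type) (_ : Finite I) (_ : Nonempty I) (γ : I → MultisetType)
    (P : ∀ i, Pres.{u} (γ i).voc σ.voc),
    (∀ i, IsPosPres N (γ i).structures.{u} σ.structures.{u} (P i)) ∧
      ∀ B ∈ σ.structures.{u}, ∃ i A e, P i A B e

/-- The iterated coproduct of the types of the cover lets a quantifier-free formula read off the
index, at the price of respecting nullary names from here on. -/
theorem HasCover.exists_isFullPres {N : ℕ} {σ : MultisetType} (h : HasCover.{u} N σ) :
    ∃ (γ : MultisetType) (P : Pres.{u} γ.voc σ.voc),
      IsFullPres N γ.structures.{u} σ.structures.{u} P ∧ ∀ B ∈ σ.structures.{u}, ∃ A e, P A B e := by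
  obtain ⟨I, _, ⟨i₀⟩, γ, P, hP, hS⟩ := h
  have hl : ∀ l : List I, ∃ (δ : MultisetType) (Q : Pres.{u} δ.voc σ.voc),
      IsFullPres N δ.structures.{u} σ.structures.{u} Q ∧
        ∀ i ∈ l, ∀ A B e, P i A B e → ∃ A' e', Q A' B e' := by
    intro l
    induction l with
    -- No multiset type is empty, so the empty list needs a default member of the cover; hence the
    -- index type is required to be nonempty.
    | nil => exact ⟨γ i₀, P i₀, (hP i₀).isFullPres, by simp⟩
    | cons i l ih =>
      obtain ⟨δ, Q, hQ, H⟩ := ih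
      refine ⟨(γ i).sum δ, sumPres (P i) Q, (hP i).isFullPres.sum hQ, ?_⟩
      intro j hj A B e hB
      rcases List.mem_cons.1 hj with rfl | hj
      · exact ⟨leftStructure _ A, e, Or.inl ⟨A, e, hB, Language.Equiv.refl _ _, fun _ => rfl⟩⟩
      · obtain ⟨A', e', h'⟩ := H j hj A B e hB
        exact ⟨rightStructure _ A', e', Or.inr ⟨A', e', h', Language.Equiv.refl _ _, fun _ => rfl⟩⟩
  have := Fintype.ofFinite I
  obtain ⟨δ, Q, hQ, H⟩ := hl Finset.univ.toList
  refine ⟨δ, Q, hQ, fun B hB => ?_⟩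
  obtain ⟨i, A, e, h⟩ := hS B hB
  exact H i (by simp) A B e h

theorem hasCover_one (N : ℕ) : HasCover.{u} N one := by
  refine ⟨Unit, inferInstance, inferInstance, fun _ => one,
    fun _ A B _ => Nat.card A = 1 ∧ Nat.card B = 1, fun _ => ⟨⟨fun h => h.1, fun h => h.2, ?_, ?_⟩,
    ?_, ?_⟩, ?_⟩
  · rintro A B e ⟨-, hB⟩
    have := (Nat.card_eq_one_iff_unique.1 hB).1
    exact Function.injective_of_subsingleton e
  · exact fun A hA => ⟨A, id, hA, hA⟩
  · rintro A B e A' B' e' ⟨hA, hB⟩ ⟨hA', hB'⟩ p - a a' -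
    have h₁ := Nat.card_eq_one_iff_unique.1 hA
    have h₂ := Nat.card_eq_one_iff_unique.1 hA'
    obtain ⟨b⟩ := (Nat.card_eq_one_iff_unique.1 hB).2
    obtain ⟨b'⟩ := (Nat.card_eq_one_iff_unique.1 hB').2
    exact iff_of_true ⟨b, h₁.1.elim _ _⟩ ⟨b', h₂.1.elim _ _⟩
  · rintro A B e A' B' e' ⟨hA, hB⟩ ⟨hA', hB'⟩ p - r -
    have h₁ := Nat.card_eq_one_iff_unique.1 hB
    have h₂ := Nat.card_eq_one_iff_unique.1 hB'
    obtain ⟨b⟩ := h₁.2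
    obtain ⟨b'⟩ := h₂.2
    refine EF.of_backForth (fun _ => Set.univ) (fun r p _ => ⟨fun _ _ => ?_, fun R => ?_⟩)
      (fun _ _ _ _ => ⟨b', trivial⟩) (fun _ _ _ _ => ⟨b, trivial⟩) trivial
    · exact iff_of_true (h₁.1.elim _ _) (h₂.1.elim _ _)
    · exact (R : Empty).elim
  · exact fun B hB => ⟨(), B, id, hB, hB⟩

theorem HasCover.prod {N : ℕ} {σ τ : MultisetType} (hσ : HasCover.{u} N σ)
    (hτ : HasCover.{u} N τ) : HasCover.{u} N (σ.prod τ) := by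
  obtain ⟨I, _, _, γ, P, hP, hPS⟩ := hσ
  obtain ⟨J, _, _, δ, Q, hQ, hQS⟩ := hτ
  refine ⟨I × J, inferInstance, inferInstance, fun i => (γ i.1).prod (δ i.2),
    fun i => prodPres (P i.1) (Q i.2), fun i => (hP i.1).prod (hQ i.2), ?_⟩
  rintro B ⟨B₁, hB₁, B₂, hB₂, ⟨h⟩⟩
  obtain ⟨i, A₁, e₁, H₁⟩ := hPS B₁ hB₁
  obtain ⟨j, A₂, e₂, H₂⟩ := hQS B₂ hB₂
  exact ⟨(i, j), pairStructure A₁ A₂, fun b => pairMap e₁ e₂ (h b), A₁, B₁, e₁, A₂, B₂, e₂, H₁, H₂,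
    Language.Equiv.refl _ _, h, fun _ => rfl⟩

/-- A presentation, followed by a function between structures that preserves universes. -/
def mapPres {L L' L'' : FirstOrder.Language.{0, 0}} (P : Pres.{u} L L')
    (F : Bundled.{u} L'.Structure → Bundled.{u} L''.Structure) (f : ∀ B, F B ≃ B) :
    Pres.{u} L L'' := fun A C e =>
  ∃ B e₁, P A B e₁ ∧ ∃ g : C ≃[L''] F B, ∀ c, e c = e₁ (f B (g c))

/-- The function `F` acts on the presented side only: ranges stay the same because the universes are
identified, and games transfer by `hEF`. The instances needed are the two inclusions into a
coproduct. -/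
theorem IsPosPres.map {L L' L'' : FirstOrder.Language.{0, 0}} {N : ℕ}
    {K : Set (Bundled.{u} L.Structure)} {K' : Set (Bundled.{u} L'.Structure)}
    {K'' : Set (Bundled.{u} L''.Structure)} {P : Pres.{u} L L'} (hP : IsPosPres N K K' P)
    (F : Bundled.{u} L'.Structure → Bundled.{u} L''.Structure) (f : ∀ B, F B ≃ B)
    (hF : ∀ B ∈ K', ∀ C : Bundled.{u} L''.Structure, Nonempty (C ≃[L''] F B) → C ∈ K'')
    (hEF : ∀ (B B' : Bundled.{u} L'.Structure) (p : Set (B × B')) r, L'.EF r p → L''.EF r (pull (f B) (f B') p)) :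
    IsPosPres N K K'' (mapPres P F f) where
  mem_left := by
    rintro A C e ⟨B, e₁, H, -⟩
    exact hP.mem_left H
  mem_right := by
    rintro A C e ⟨B, e₁, H, g, -⟩
    exact hF B (hP.mem_right H) C ⟨g⟩
  injective := by
    rintro A C e ⟨B, e₁, H, g, he⟩ c c' hc
    rw [he, he] at hc
    exact g.injective ((f B).injective (hP.injective H hc))
  total := by
    intro A hA
    obtain ⟨B, e, H⟩ := hP.total A hA
    exact ⟨F B, fun c => e (f B c), B, e, H, Language.Equiv.refl _ _, fun _ => rfl⟩
  range_iff := by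
    have hr : ∀ {A : Type u} {B : Bundled.{u} L'.Structure} {C : Bundled.{u} L''.Structure}
        {e : C → A} {e₁ : B → A} (g : C ≃[L''] F B), (∀ c, e c = e₁ (f B (g c))) →
        Set.range e = Set.range e₁ := by
      intro A B C e e₁ g he
      have : e = e₁ ∘ (f B ∘ g) := funext he
      rw [this]
      exact ((f B).surjective.comp g.surjective).range_comp e₁
    rintro A C e A' C' e' ⟨B, e₁, H, g, he⟩ ⟨B', e₁', H', g', he'⟩ p hp a a' ha
    rw [hr g he, hr g' he']
    exact hP.range_iff H H' hp ha
  ef := by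
    rintro A C e A' C' e' ⟨B, e₁, H, g, he⟩ ⟨B', e₁', H', g', he'⟩ p hp r hr
    refine ((hEF _ _ _ _ (hP.ef H H' hp hr)).pull_equiv g g').mono fun z hz => ?_
    simpa [he, he'] using hz

/-- The two covers are put side by side as indices. A coproduct of the presenting types would not
do, since it tells the summands apart by a nullary name. -/
theorem HasCover.sum {N : ℕ} {σ τ : MultisetType} (hσ : HasCover.{u} N σ)
    (hτ : HasCover.{u} N τ) : HasCover.{u} N (σ.sum τ) := by
  obtain ⟨I, _, _, γ, P, hP, hPS⟩ := hσ
  obtain ⟨J, _, _, δ, Q, hQ, hQS⟩ := hτ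
  have h₁ := fun i => (hP i).map (K'' := (σ.sum τ).structures) (leftStructure τ.voc)
    (fun B => Equiv.refl B) (fun B hB C hC => Or.inl ⟨B, hB, hC⟩) (fun _ _ _ _ h => ef_leftStructure h)
  have h₂ := fun j => (hQ j).map (K'' := (σ.sum τ).structures) (rightStructure σ.voc)
    (fun B => Equiv.refl B) (fun B hB C hC => Or.inr ⟨B, hB, hC⟩) (fun _ _ _ _ h => ef_rightStructure h)
  refine ⟨I ⊕ J, inferInstance, inferInstance, Sum.elim γ δ, fun i => match i with
    | .inl i => mapPres (P i) (leftStructure τ.voc) fun B => Equiv.refl B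
    | .inr j => mapPres (Q j) (rightStructure σ.voc) fun B => Equiv.refl B, fun i => match i with
    | .inl i => h₁ i
    | .inr j => h₂ j, ?_⟩
  rintro C (⟨B, hB, ⟨g⟩⟩ | ⟨B, hB, ⟨g⟩⟩)
  · obtain ⟨i, A, e, H⟩ := hPS B hB
    exact ⟨.inl i, A, fun b => e (g b), B, e, H, g, fun _ => rfl⟩
  · obtain ⟨i, A, e, H⟩ := hQS B hB
    exact ⟨.inr i, A, fun b => e (g b), B, e, H, g, fun _ => rfl⟩

/-! ### From presentations to interpretations -/

theorem encard_range_fin_le {α : Type u} {k : ℕ} (f : Fin k → α) : (Set.range f).encard ≤ k := by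
  rw [← Set.image_univ]
  exact (Set.encard_image_le f _).trans (by simp)

theorem pIso_range_diag {L : FirstOrder.Language.{0, 0}} {A : Type u} [L.Structure A] {k : ℕ}
    (a : Fin k → A) : L.PIso (Set.range fun i => (a i, a i)) := by
  have h : ∀ {x y}, (x, y) ∈ Set.range (fun i => (a i, a i)) → x = y := by
    rintro x y ⟨i, hi⟩
    exact (congrArg Prod.fst hi).symm.trans (congrArg Prod.snd hi)
  refine ⟨fun h₁ h₂ => by rw [h h₁, h h₂], fun R x y hxy => ?_⟩
  rw [funext fun i => h (hxy i)]

section Interpretation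

variable {L L' : FirstOrder.Language.{0, 0}} {N : ℕ} {K : Set (Bundled.{u} L.Structure)}
  {K' : Set (Bundled.{u} L'.Structure)} {P : Pres.{u} L L'}

/-- The entries of `a'` come from the presented structure by `range_iff`. The position has at most
`k` pairs, so `r` rounds remain, enough for `φ`. -/
theorem IsFullPres.realize [L'.IsRelational] (hP : IsFullPres N K K' P) {k r : ℕ}
    (φ : L'.Formula (Fin k)) (hφ : quantifierRank φ ≤ r) (hN : k + r ≤ N) {A B e A' B' e'}
    (H : P A B e) (H' : P A' B' e') {b : Fin k → B} {a' : Fin k → A'}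
    (hp : L.PIso (Set.range fun i => (e (b i), a' i))) (hb : φ.Realize b) :
    ∃ b' : Fin k → B', (∀ i, a' i = e' (b' i)) ∧ φ.Realize b' := by
  have hr : ∀ i, a' i ∈ Set.range e' := fun i =>
    (hP.range_iff H H' hp ⟨i, rfl⟩).1 ⟨_, rfl⟩
  choose b' hb' using hr
  refine ⟨b', fun i => (hb' i).symm, ?_⟩
  have hE := hP.ef H H' hp (r := r) <| by
    refine (add_le_add_left (encard_range_fin_le _) _).trans ?_
    exact_mod_cast hN
  exact (hE.realize_iff φ hφ (fun i => ⟨i, by simp [hb']⟩) (fun i => i.elim0)).1 hb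

/-- The property of tuples of `A` that they satisfy `φ` in the presented structure. -/
def Holds (P : Pres.{u} L L') {k : ℕ} (φ : L'.Formula (Fin k)) (A : Bundled.{u} L.Structure)
    (a : Fin k → A) : Prop :=
  ∃ B e, P A B e ∧ ∃ b : Fin k → B, (∀ i, a i = e (b i)) ∧ φ.Realize b

/-- One `A` may present several structures in several ways. The identity on a tuple of `A` is a
partial isomorphism, so the choice does not affect the truth of `φ`. -/
theorem IsFullPres.holds_iff [L'.IsRelational] (hP : IsFullPres N K K' P) {k r : ℕ}
    (φ : L'.Formula (Fin k)) (hφ : quantifierRank φ ≤ r) (hN : k + r ≤ N) {A B e} (H : P A B e)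
    (b : Fin k → B) : Holds P φ A (fun i => e (b i)) ↔ φ.Realize b := by
  refine ⟨?_, fun h => ⟨B, e, H, b, fun _ => rfl, h⟩⟩
  rintro ⟨B', e', H', b', he, hb'⟩
  obtain ⟨c, hc, h⟩ := hP.realize φ hφ hN H' H (a' := fun i => e (b i)) (b := b')
    (by simpa only [he] using pIso_range_diag fun i => e' (b' i)) hb'
  rwa [show b = c from funext fun i => hP.injective H (hc i)]

theorem IsFullPres.exists_isQF [L.IsRelational] [Finite (Σ k, L.Relations k)] [L'.IsRelational]
    (hP : IsFullPres N K K' P) {k r : ℕ} (φ : L'.Formula (Fin k)) (hφ : quantifierRank φ ≤ r)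
    (hN : k + r ≤ N) :
    ∃ ψ : L.Formula (Fin k), ψ.IsQF ∧ ∀ A ∈ K, ∀ a : Fin k → A, ψ.Realize a ↔ Holds P φ A a := by
  refine exists_isQF_of_invariant K (Holds P φ) ?_
  rintro A - A' hA' a a' hp ⟨B, e, H, b, hb, hφb⟩
  obtain ⟨B', e', H'⟩ := hP.total A' hA'
  obtain ⟨b', hb'⟩ := hP.realize φ hφ hN H H' (by simpa only [hb] using hp) hφb
  exact ⟨B', e', H', b', hb'⟩

theorem IsFullPres.range_eq (hP : IsFullPres N K K' P) {A B e B' e'} (H : P A B e)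
    (H' : P A B' e') : Set.range e = Set.range e' := by
  ext a
  exact hP.range_iff H H' (pIso_range_diag fun _ : Fin 1 => a) ⟨0, rfl⟩

/-- The range of a presentation is invariant under partial isomorphisms, which yields the universe
formula. A relation of arity `k` is an atomic formula in `k` variables, so it is invariant once `k ≤
N`. -/
theorem IsFullPres.exists_interpretation [L.IsRelational] [Finite (Σ k, L.Relations k)]
    [L'.IsRelational] (hP : IsFullPres N K K' P) (hN : ∀ k, Nonempty (L'.Relations k) → k ≤ N) :
    ∃ f : NonCopyingInterpretation L L', ∀ A B e, P A B e →
      (∀ a, f.InUniverse A a ↔ a ∈ Set.range e) ∧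
      ∃ g : B ≃[L'] f.apply A, ∀ b, (g b).1 = e b := by
  have hU := exists_isQF_of_invariant (m := 1) K (fun A a => ∃ B e, P A B e ∧ a 0 ∈ Set.range e) <| by
    rintro A - A' hA' a a' hp ⟨B, e, H, ha⟩
    obtain ⟨B', e', H'⟩ := hP.total A' hA'
    exact ⟨B', e', H', (hP.range_iff H H' hp ⟨0, rfl⟩).1 ha⟩
  obtain ⟨δ, -, hδ⟩ := hU
  have hR : ∀ {k : ℕ} (R : L'.Relations k), ∃ ψ : L.Formula (Fin k), ψ.IsQF ∧
      ∀ A ∈ K, ∀ a : Fin k → A, ψ.Realize a ↔ Holds P (R.formula fun i => Term.var i) A a :=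
    fun {k} R => hP.exists_isQF (r := 0) _ le_rfl (hN k ⟨R⟩)
  choose θ _ hθ using @hR
  refine ⟨⟨δ, θ⟩, fun A B e H => ?_⟩
  have hu : ∀ a, NonCopyingInterpretation.InUniverse ⟨δ, θ⟩ A a ↔ a ∈ Set.range e := by
    intro a
    refine (hδ A (hP.mem_left H) _).trans ⟨?_, fun h => ⟨B, e, H, h⟩⟩
    rintro ⟨B', e', H', h⟩
    rwa [hP.range_eq H H']
  refine ⟨hu, ⟨⟨(Equiv.ofInjective e (hP.injective H)).trans
    (Equiv.subtypeEquivRight fun a => (hu a).symm), fun F => isEmptyElim F, fun {k} R x => ?_⟩,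
    fun b => rfl⟩⟩
  refine (hθ R A (hP.mem_left H) _).trans ((hP.holds_iff (r := 0) _ le_rfl (hN k ⟨R⟩) H x).trans ?_)
  simp [Formula.realize_rel]

end Interpretation

/-- The output of the interpretation on `A` is isomorphic over `A` to any structure that `A`
presents, so truth of `φ` in the output amounts to `Holds`, which is quantifier-free definable. -/
theorem exists_quantifierElimination {σ : MultisetType} {N : ℕ} (r n : ℕ) (hN : n + r ≤ N)
    (hR : ∀ k, Nonempty (σ.voc.Relations k) → k ≤ N) (h : HasCover.{u} N σ) :
    ∃ (γ : MultisetType) (f : NonCopyingInterpretation γ.voc σ.voc),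
      f.MapsClass γ.structures.{u} σ.structures.{u} ∧
      f.SurjectiveOnClass γ.structures.{u} σ.structures.{u} ∧
      ∀ φ : σ.voc.Formula (Fin n), quantifierRank φ ≤ r →
        ∃ ψ : γ.voc.Formula (Fin n), ψ.IsQF ∧
          ∀ A ∈ γ.structures.{u}, ∀ a : Fin n → A,
            ψ.Realize a ↔
              ∃ h : ∀ i, f.InUniverse A (a i),
                φ.Realize (M := f.apply A) fun i => ⟨a i, h i⟩ := by
  obtain ⟨γ, P, hP, hS⟩ := h.exists_isFullPres
  have := finite_relations γ
  obtain ⟨f, hf⟩ := hP.exists_interpretation hR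
  refine ⟨γ, f, fun A hA => ?_, fun B hB => ?_, fun φ hφ => ?_⟩
  · obtain ⟨B, e, H⟩ := hP.total A hA
    obtain ⟨-, g, -⟩ := hf A B e H
    exact mem_structures_of_equiv (hP.mem_right H) g.symm
  · obtain ⟨A, e, H⟩ := hS B hB
    obtain ⟨-, g, -⟩ := hf A B e H
    exact ⟨A, hP.mem_left H, ⟨g.symm⟩⟩
  · obtain ⟨ψ, hψ, H⟩ := hP.exists_isQF φ hφ hN
    refine ⟨ψ, hψ, fun A hA a => (H A hA a).trans ?_⟩
    obtain ⟨B, e, HB⟩ := hP.total A hA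
    obtain ⟨hu, g, hg⟩ := hf A B e HB
    have key : ∀ (b : Fin n → B) (h : ∀ i, f.InUniverse A (e (b i))),
        φ.Realize (M := f.apply A) (fun i => ⟨e (b i), h i⟩) ↔ φ.Realize b := by
      intro b h
      rw [← StrongHomClass.realize_formula g φ]
      exact iff_of_eq (congrArg _ (funext fun i => Subtype.ext (hg (b i)).symm))
    constructor
    · rintro ⟨B', e', H', b', hb', hφb⟩
      have hr : ∀ i, a i ∈ Set.range e := fun i => by
        rw [hP.range_eq HB H', hb']
        exact ⟨_, rfl⟩
      choose b hb using hr
      obtain rfl : (fun i => e (b i)) = a := funext hb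
      exact ⟨fun i => (hu _).2 ⟨_, rfl⟩, (key b _).2
        ((hP.holds_iff φ hφ hN HB b).1 ⟨B', e', H', b', hb', hφb⟩)⟩
    · rintro ⟨h, hφa⟩
      choose b hb using fun i => (hu (a i)).1 (h i)
      obtain rfl : (fun i => e (b i)) = a := funext hb
      exact ⟨B, e, HB, b, fun _ => rfl, (key b h).1 hφa⟩

end MultisetType

namespace MultisetType

open FirstOrder.Language FirstOrder.Language.Structure

/-! ### Multisets indexed by an arbitrary type -/

section MultisetStr

variable {L : FirstOrder.Language.{0, 0}} {J J' : Type}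

/-- The structure `multisetStructure` for a family that is indexed by an arbitrary type. -/
def multisetStr (B : J → Bundled.{u} L.Structure) : Bundled.{u} (multisetVoc L).Structure where
  α := Option (Σ j, B j)
  str :=
    { funMap := fun F => Empty.elim F
      RelMap := fun {_} R => match R with
        | .old R => fun x => ∃ (j : J) (y : _ → B j), x = (fun k => some ⟨j, y k⟩) ∧ RelMap R y
        | .lifted R => fun x => ∃ (j : J) (b : B j),
            x 0 = some ⟨j, b⟩ ∧ RelMap (M := B j) R Fin.elim0
        | .sim => fun x => ∃ (j : J) (a b : B j), x 0 = some ⟨j, a⟩ ∧ x 1 = some ⟨j, b⟩ }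

theorem multisetStr_fin {m : ℕ} (B : Fin m → Bundled.{u} L.Structure) :
    multisetStr B = multisetStructure B := rfl

/-- The root of a multiset. -/
def multisetRoot (B : J → Bundled.{u} L.Structure) : multisetStr B := (none : Option (Σ j, B j))

/-- The inclusion of a component into a multiset. -/
def multisetEmb (B : J → Bundled.{u} L.Structure) (j : J) (b : B j) : multisetStr B :=
  (some ⟨j, b⟩ : Option (Σ j, B j))

variable {B : J → Bundled.{u} L.Structure} {B' : J' → Bundled.{u} L.Structure}

theorem multiset_cases (z : multisetStr B) : z = multisetRoot B ∨ ∃ j b, z = multisetEmb B j b := by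
  rcases (show Option (Σ j, B j) from z) with _ | ⟨j, b⟩
  exacts [Or.inl rfl, Or.inr ⟨j, b, rfl⟩]

theorem multisetEmb_ne_root (j : J) (b : B j) : multisetEmb B j b ≠ multisetRoot B :=
  Option.some_ne_none _

theorem multisetEmb_injective (j : J) : (multisetEmb B j).Injective := fun _ _ h =>
  eq_of_heq (Sigma.mk.inj (Option.some_injective _ h)).2

theorem index_eq_of_multisetEmb_eq {j j' : J} {b : B j} {b' : B j'}
    (h : multisetEmb B j b = multisetEmb B j' b') : j = j' :=
  (Sigma.mk.inj (Option.some_injective _ h)).1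

theorem relMap_old {k : ℕ} (R : L.Relations (k + 1)) (j : J) (x : Fin (k + 1) → B j) :
    RelMap (L := multisetVoc L) (M := multisetStr B) (MultisetRel.old R)
      (fun i => multisetEmb B j (x i)) ↔ RelMap R x := by
  constructor
  · rintro ⟨j', y, hy, h⟩
    obtain rfl : j = j' := index_eq_of_multisetEmb_eq (congrFun hy 0)
    obtain rfl : x = y := funext fun i => multisetEmb_injective j (congrFun hy i)
    exact h
  · exact fun h => ⟨j, x, rfl, h⟩

theorem relMap_sim (z w : multisetStr B) :
    RelMap (L := multisetVoc L) (M := multisetStr B) MultisetRel.sim ![z, w] ↔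
      ∃ j a b, z = multisetEmb B j a ∧ w = multisetEmb B j b := Iff.rfl

/-- Reindexing a multiset. -/
theorem nonempty_multisetStr_equiv (ε : J ≃ J') (B' : J' → Bundled.{u} L.Structure) :
    Nonempty (multisetStr (fun j => B' (ε j)) ≃[multisetVoc L] multisetStr B') := by
  let f : (Σ j, B' (ε j)) ≃ Σ j, B' j := ε.sigmaCongrLeft (β := fun j => B' j)
  let g : multisetStr (fun j => B' (ε j)) ≃ multisetStr B' := Equiv.optionCongr f
  have hg : ∀ j b, g (multisetEmb _ j b) = multisetEmb B' (ε j) b := fun _ _ => rfl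
  refine ⟨⟨g, fun F => (F : Empty).elim, fun {k} R x => ?_⟩⟩
  cases R with
  | old R =>
    constructor
    · rintro ⟨j', y, hy, h⟩
      obtain ⟨j, rfl⟩ := ε.surjective j'
      refine ⟨j, y, funext fun i => g.injective ?_, h⟩
      exact congrFun hy i
    · rintro ⟨j, y, rfl, h⟩
      exact ⟨ε j, y, rfl, h⟩
  | lifted R =>
    constructor
    · rintro ⟨j', b, hb, h⟩
      obtain ⟨j, rfl⟩ := ε.surjective j'
      exact ⟨j, b, g.injective hb, h⟩
    · rintro ⟨j, b, hb, h⟩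
      exact ⟨ε j, b, (congrArg g hb), h⟩
  | sim =>
    constructor
    · rintro ⟨j', a, b, ha, hb⟩
      obtain ⟨j, rfl⟩ := ε.surjective j'
      exact ⟨j, a, b, g.injective ha, g.injective hb⟩
    · rintro ⟨j, a, b, ha, hb⟩
      exact ⟨ε j, a, b, congrArg g ha, congrArg g hb⟩

theorem mem_multisetClass_of_equiv_multisetStr [Finite J] {K : Set (Bundled.{u} L.Structure)}
    (hB : ∀ j, B j ∈ K) {M : Bundled.{u} (multisetVoc L).Structure}
    (h : M ≃[multisetVoc L] multisetStr B) : M ∈ multisetClass K := by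
  obtain ⟨m, ⟨ε⟩⟩ := Finite.exists_equiv_fin J
  obtain ⟨g⟩ := nonempty_multisetStr_equiv ε.symm B
  rw [multisetStr_fin] at g
  exact ⟨m, _, fun i => hB _, ⟨g.symm.comp h⟩⟩

theorem exists_equiv_multisetStr {K : Set (Bundled.{u} L.Structure)}
    {M : Bundled.{u} (multisetVoc L).Structure} (hM : M ∈ multisetClass K) :
    ∃ (m : ℕ) (B : Fin m → Bundled.{u} L.Structure), (∀ i, B i ∈ K) ∧
      Nonempty (M ≃[multisetVoc L] multisetStr B) := by
  obtain ⟨m, B, hB, ⟨g⟩⟩ := hM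
  rw [← multisetStr_fin] at g
  exact ⟨m, B, hB, ⟨g⟩⟩

/-! ### Games on multisets -/

/-- A position on two multisets that is matched by a partial bijection `π` between the components:
it is winning in all matched pairs of components. -/
def Matched {I : Type} (B : J → Bundled.{u} L.Structure) (B' : J' → Bundled.{u} L.Structure)
    (col : J → I) (col' : J' → I) (N r : ℕ) (p : Set (multisetStr B × multisetStr B')) : Prop :=
  ∃ π : Set (J × J'), π.encard + r ≤ N ∧ (∀ v ∈ π, ∀ w ∈ π, v.1 = w.1 ↔ v.2 = w.2) ∧
    (∀ w ∈ π, col w.1 = col' w.2) ∧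
    (∀ z z', (z, z') ∈ p → (z = multisetRoot B ∧ z' = multisetRoot B') ∨
      ∃ w ∈ π, ∃ b b', z = multisetEmb B w.1 b ∧ z' = multisetEmb B' w.2 b') ∧
    ∀ w ∈ π, L.EF r (pull (multisetEmb B w.1) (multisetEmb B' w.2) p)

variable {I : Type} {col : J → I} {col' : J' → I} {N : ℕ}

theorem Matched.swap {r : ℕ} {p : Set (multisetStr B × multisetStr B')}
    (h : Matched B B' col col' N r p) : Matched B' B col' col N r (Prod.swap ⁻¹' p) := by
  obtain ⟨π, hr, hπ, hc, hp, hE⟩ := h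
  refine ⟨Prod.swap ⁻¹' π, ?_, fun v hv w hw => (hπ _ hv _ hw).symm, fun w hw => (hc _ hw).symm,
    fun z z' hz => ?_, fun w hw => (hE _ hw).swap⟩
  · rw [← Set.image_swap_eq_preimage_swap, Prod.swap_injective.encard_image]
    exact hr
  · rcases hp _ _ hz with h | ⟨w, hw, b, b', h, h'⟩
    · exact Or.inl h.symm
    · exact Or.inr ⟨w.swap, by simpa using hw, b', b, h', h⟩

/-- Every relation of a multiset, `sim` included, lives inside one component. Elements of one
component go to one component because `π` is a partial bijection, and there the winning position
respects the names of `L`. A lifted name is a nullary fact about the component, which that position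
respects as well. -/
theorem Matched.pIso {r : ℕ} {p : Set (multisetStr B × multisetStr B')}
    (h : Matched B B' col col' N r p) : (multisetVoc L).PIso p := by
  -- Only one direction is proved; the other is its instance for the swapped position, hence the
  -- generality in both families.
  have key : ∀ {J J' : Type} {B : J → Bundled.{u} L.Structure} {B' : J' → Bundled.{u} L.Structure}
      {col : J → I} {col' : J' → I} {p : Set (multisetStr B × multisetStr B')},
      Matched B B' col col' N r p →
      (∀ z z' w w', (z, z') ∈ p → (w, w') ∈ p → z = w → z' = w') ∧
      ∀ {k : ℕ} (R : MultisetRel L k) (x : Fin k → multisetStr B) (y : Fin k → multisetStr B'),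
        (∀ i, (x i, y i) ∈ p) → RelMap (L := multisetVoc L) (M := multisetStr B) R x →
        RelMap (L := multisetVoc L) (M := multisetStr B') R y := by
    clear h
    rintro J J' B B' col col' p ⟨π, -, hπ, -, hp, hE⟩
    have hj : ∀ {j b z'}, (multisetEmb B j b, z') ∈ p →
        ∃ j' b', (j, j') ∈ π ∧ z' = multisetEmb B' j' b' := by
      intro j b z' hz
      rcases hp _ _ hz with ⟨h, -⟩ | ⟨⟨j₁, j'⟩, hw, b₁, b', h, h'⟩
      · exact (multisetEmb_ne_root _ _ h).elim
      · obtain rfl := index_eq_of_multisetEmb_eq h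
        exact ⟨j', b', hw, h'⟩
    refine ⟨?_, ?_⟩
    · rintro z z' w w' hz hw rfl
      rcases multiset_cases z with rfl | ⟨j, b, rfl⟩
      · have : ∀ {z'}, (multisetRoot B, z') ∈ p → z' = multisetRoot B' := by
          intro z' hz
          rcases hp _ _ hz with ⟨-, h⟩ | ⟨w, -, b, -, h, -⟩
          · exact h
          · exact (multisetEmb_ne_root _ _ h.symm).elim
        rw [this hz, this hw]
      · obtain ⟨j₁, b₁, h₁, rfl⟩ := hj hz
        obtain ⟨j₂, b₂, h₂, rfl⟩ := hj hw
        obtain rfl : j₁ = j₂ := (hπ _ h₁ _ h₂).1 rfl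
        rw [((hE _ h₁).pIso.eq_iff hz hw).1 rfl]
    · intro k R x y hxy hx
      cases R with
      | old R =>
        obtain ⟨j, x, rfl, hx⟩ := hx
        obtain ⟨j', -, hw, -⟩ := hj (hxy 0)
        have hy : ∀ i, ∃ b', y i = multisetEmb B' j' b' := fun i => by
          obtain ⟨j₁, b₁, h₁, hb₁⟩ := hj (hxy i)
          obtain rfl : j₁ = j' := (hπ _ h₁ _ hw).1 rfl
          exact ⟨b₁, hb₁⟩
        choose b' hb' using hy
        obtain rfl := funext hb'
        exact (relMap_old R _ b').2 (((hE _ hw).pIso.rel_iff R x b' hxy).1 hx)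
      | lifted R =>
        obtain ⟨j, b, hb, hx⟩ := hx
        obtain ⟨j', b', hw, h'⟩ := hj (hb ▸ hxy 0)
        exact ⟨j', b', h', ((hE _ hw).pIso.rel_iff R Fin.elim0 Fin.elim0 fun i => i.elim0).1 hx⟩
      | sim =>
        obtain ⟨j, a, b, ha, hb⟩ := hx
        obtain ⟨j₁, b₁, h₁, h₁'⟩ := hj (ha ▸ hxy 0)
        obtain ⟨j₂, b₂, h₂, h₂'⟩ := hj (hb ▸ hxy 1)
        obtain rfl : j₁ = j₂ := (hπ _ h₁ _ h₂).1 rfl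
        exact ⟨j₁, b₁, b₂, h₁', h₂'⟩
  refine ⟨fun hz hw => ⟨(key h).1 _ _ _ _ hz hw, (key h.swap).1 _ _ _ _ hz hw⟩,
    fun R x y hxy => ⟨(key h).2 R x y hxy, (key h.swap).2 R y x hxy⟩⟩

/-- The numbers of components of every colour agree, or both are at least `N`. -/
def SimilarCount (col : J → I) (col' : J' → I) (N : ℕ) : Prop :=
  ∀ i, {j | col j = i}.ncard = {j | col' j = i}.ncard ∨
    N ≤ {j | col j = i}.ncard ∧ N ≤ {j | col' j = i}.ncard

theorem SimilarCount.symm (h : SimilarCount col col' N) : SimilarCount col' col N := fun i =>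
  (h i).imp Eq.symm And.symm

/-- Let `σ` be the set of matched pairs of the colour of `j`, so `σ.ncard < N`. If every component
of this colour on the right were matched, there would be at most `σ.ncard` of them, while the left
has at least one more because of `j`. The counts would differ with one of them below `N`. -/
theorem SimilarCount.exists_unmatched [Finite J] [Finite J'] (h : SimilarCount col col' N)
    {π : Set (J × J')} (hN : π.ncard < N) (hπ : ∀ v ∈ π, ∀ w ∈ π, v.1 = w.1 ↔ v.2 = w.2)
    (hc : ∀ w ∈ π, col w.1 = col' w.2) {j : J} (hj : ∀ w ∈ π, w.1 ≠ j) :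
    ∃ j', col' j' = col j ∧ ∀ w ∈ π, w.2 ≠ j' := by
  by_contra! hno
  set σ : Set (J × J') := {w ∈ π | col w.1 = col j}
  have hσ : σ.ncard < N := (Set.ncard_le_ncard (Set.sep_subset _ _)).trans_lt hN
  have h₁ : {j' | col' j' = col j}.ncard ≤ σ.ncard := by
    refine (Set.ncard_le_ncard ?_).trans (Set.ncard_image_le (f := Prod.snd))
    intro j' hj'
    obtain ⟨w, hw, rfl⟩ := hno j' hj'
    exact ⟨w, ⟨hw, (hc w hw).trans hj'⟩, rfl⟩
  have h₂ : σ.ncard + 1 ≤ {j' | col j' = col j}.ncard := by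
    have hi : Set.InjOn Prod.fst σ := fun v hv w hw hvw =>
      Prod.ext hvw ((hπ v hv.1 w hw.1).1 hvw)
    have hn : j ∉ Prod.fst '' σ := by
      rintro ⟨w, hw, h⟩
      exact hj w hw.1 h
    rw [← hi.ncard_image, ← Set.ncard_insert_of_notMem hn]
    refine Set.ncard_le_ncard ?_
    rintro _ (rfl | ⟨w, hw, rfl⟩)
    exacts [rfl, hw.2]
  rcases h (col j) with h | h <;> omega

/-- The root is answered by the root, and a move in a matched component by the strategy there. A
move in a fresh component is answered in an unmatched one of the same colour, starting from the
empty position. -/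
theorem Matched.forth [Finite J] [Finite J'] (h : SimilarCount col col' N)
    (hB : ∀ j j', col j = col' j' → ∀ s ≤ N, L.EF s (∅ : Set (B j × B' j'))) {r : ℕ}
    {p : Set (multisetStr B × multisetStr B')} (hp : Matched B B' col col' N (r + 1) p)
    (z : multisetStr B) : ∃ z', Matched B B' col col' N r (insert (z, z') p) := by
  obtain ⟨π, hr, hπ, hc, hp, hE⟩ := hp
  have hr' : π.encard + 1 + r ≤ N := by
    rw [add_assoc, add_comm 1]
    exact_mod_cast hr
  rcases multiset_cases z with rfl | ⟨j, b, rfl⟩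
  · refine ⟨multisetRoot B', π, le_trans (by gcongr; exact le_self_add) hr', hπ, hc, ?_, ?_⟩
    · rintro z z' (hz | hz)
      · exact Or.inl (Prod.mk.inj hz)
      · exact hp z z' hz
    · refine fun w hw => (hE w hw).of_succ.mono ?_
      rintro v (hv | hv)
      · exact (multisetEmb_ne_root _ _ (Prod.mk.inj hv).1).elim
      · exact hv
  · by_cases hj : ∃ w ∈ π, w.1 = j
    · obtain ⟨⟨j, j'⟩, hw, rfl⟩ := hj
      obtain ⟨b', hb'⟩ := (hE _ hw).2.1 b
      refine ⟨multisetEmb B' j' b', π, le_trans (by gcongr; exact le_self_add) hr', hπ, hc, ?_, ?_⟩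
      · rintro z z' (hz | hz)
        · obtain ⟨rfl, rfl⟩ := Prod.mk.inj hz
          exact Or.inr ⟨_, hw, b, b', rfl, rfl⟩
        · exact hp z z' hz
      · rintro ⟨j₁, j₁'⟩ hv
        by_cases hjj : j₁ = j
        · subst hjj
          obtain rfl : j₁' = j' := (hπ _ hv _ hw).1 rfl
          refine hb'.mono ?_
          rintro ⟨c, c'⟩ (hv | hv)
          · obtain ⟨h₁, h₂⟩ := Prod.mk.inj hv
            exact Or.inl (Prod.ext (multisetEmb_injective _ h₁) (multisetEmb_injective _ h₂))
          · exact Or.inr hv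
        · refine (hE _ hv).of_succ.mono ?_
          rintro ⟨c, c'⟩ (hv | hv)
          · exact (hjj (index_eq_of_multisetEmb_eq (Prod.mk.inj hv).1)).elim
          · exact hv
    · push Not at hj
      have hfin : π.Finite := Set.toFinite π
      have hN : π.ncard + 1 + r ≤ N := by
        rw [← hfin.cast_ncard_eq] at hr'
        exact_mod_cast hr'
      obtain ⟨j', hj', hno⟩ := h.exists_unmatched (by omega) hπ hc hj
      -- In the fresh pair the game starts with `r + 1` rounds, the first of which is the present
      -- move.
      obtain ⟨b', hb'⟩ := (hB j j' hj'.symm (r + 1) (by omega)).2.1 b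
      -- The matching gains a pair while a round is spent, so the budget is kept.
      refine ⟨multisetEmb B' j' b', insert (j, j') π, ?_, ?_, ?_, ?_, ?_⟩
      · exact (by gcongr; exact Set.encard_insert_le _ _ : _ ≤ _).trans hr'
      · rintro v (rfl | hv) w (rfl | hw)
        · exact iff_of_true rfl rfl
        · exact iff_of_false (hj w hw).symm (hno w hw).symm
        · exact iff_of_false (hj v hv) (hno v hv)
        · exact hπ v hv w hw
      · rintro w (rfl | hw)
        exacts [hj'.symm, hc w hw]
      · rintro z z' (hz | hz)
        · obtain ⟨rfl, rfl⟩ := Prod.mk.inj hz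
          exact Or.inr ⟨_, Or.inl rfl, b, b', rfl, rfl⟩
        · rcases hp z z' hz with h | ⟨w, hw, h⟩
          · exact Or.inl h
          · exact Or.inr ⟨w, Or.inr hw, h⟩
      · rintro w (rfl | hw)
        · refine hb'.mono ?_
          rintro ⟨c, c'⟩ (hv | hv)
          · obtain ⟨h₁, h₂⟩ := Prod.mk.inj hv
            exact Or.inl (Prod.ext (multisetEmb_injective _ h₁) (multisetEmb_injective _ h₂))
          · rcases hp _ _ hv with ⟨h, -⟩ | ⟨w, hw, b, b', h, -⟩
            · exact (multisetEmb_ne_root _ _ h).elim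
            · exact (hj w hw (index_eq_of_multisetEmb_eq h).symm).elim
        · refine (hE w hw).of_succ.mono ?_
          rintro ⟨c, c'⟩ (hv | hv)
          · exact (hj w hw (index_eq_of_multisetEmb_eq (Prod.mk.inj hv).1)).elim
          · exact hv

/-- Matched positions are winning, if components of the same colour cannot be distinguished and
there are similarly many of them. -/
theorem Matched.ef [Finite J] [Finite J'] (h : SimilarCount col col' N)
    (hB : ∀ j j', col j = col' j' → ∀ s ≤ N, L.EF s (∅ : Set (B j × B' j'))) {r : ℕ}
    {p : Set (multisetStr B × multisetStr B')} (hp : Matched B B' col col' N r p) :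
    (multisetVoc L).EF r p := by
  refine EF.of_backForth (fun r => {p | Matched B B' col col' N r p}) (fun r p hp => hp.pIso)
    (fun r p hp z => hp.forth h hB z) (fun r p hp z' => ?_) hp
  obtain ⟨z, hz⟩ := hp.swap.forth h.symm (fun j' j hj s hs => (hB j j' hj.symm s hs).swap) z'
  refine ⟨z, ?_⟩
  have := hz.swap
  rwa [swap_preimage_insert] at this

end MultisetStr

end MultisetType

namespace MultisetType

open FirstOrder.Language FirstOrder.Language.Structure

/-! ### Finite products with a root -/

section BigProd

/-- Ways to view structures `A` as products: families `F` of structures, a root of `A`, and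
embeddings of the `F s` into `A`. -/
abbrev BigDecomp {S : Type} (V : S → FirstOrder.Language.{0, 0}) (L : FirstOrder.Language.{0, 0}) :
    Type (u + 1) :=
  (A : Bundled.{u} L.Structure) → (F : ∀ s, Bundled.{u} (V s).Structure) → A → (∀ s, F s → A) → Prop

/-- The structures in `K` are the products of the structures in the classes `KS s` and of a root,
and partial isomorphisms respect the decomposition. -/
structure IsBigProd {S : Type} {V : S → FirstOrder.Language.{0, 0}}
    (KS : ∀ s, Set (Bundled.{u} (V s).Structure)) {L : FirstOrder.Language.{0, 0}}
    (K : Set (Bundled.{u} L.Structure)) (D : BigDecomp.{u} V L) : Prop where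
  mem_left : ∀ {A F ρ e}, D A F ρ e → A ∈ K
  mem_part : ∀ {A F ρ e}, D A F ρ e → ∀ s, F s ∈ KS s
  total : ∀ A ∈ K, ∃ F ρ e, D A F ρ e
  surj : ∀ F, (∀ s, F s ∈ KS s) → ∃ A ρ e, D A F ρ e
  ne_root : ∀ {A F ρ e}, D A F ρ e → ∀ s x, e s x ≠ ρ
  index : ∀ {A F ρ e}, D A F ρ e → ∀ {s x s' x'}, e s x = e s' x' → s = s'
  injective : ∀ {A F ρ e}, D A F ρ e → ∀ s, (e s).Injective
  root : ∀ {A F ρ e A' F' ρ' e'}, D A F ρ e → D A' F' ρ' e' → ∀ {p : Set (A × A')}, L.PIsoPos p →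
    ∀ {a'}, (ρ, a') ∈ p → a' = ρ'
  part : ∀ {A F ρ e A' F' ρ' e'}, D A F ρ e → D A' F' ρ' e' → ∀ {p : Set (A × A')}, L.PIsoPos p →
    ∀ {s x a'}, (e s x, a') ∈ p → ∃ x', a' = e' s x'
  pIsoPos : ∀ {A F ρ e A' F' ρ' e'}, D A F ρ e → D A' F' ρ' e' → ∀ {p : Set (A × A')},
    L.PIsoPos p → ∀ s, (V s).PIsoPos (pull (e s) (e' s) p)

/-- A decomposition of the first factor of a pair, extended by the second factor. -/
def optionDecomp {S : Type} {V : Option S → FirstOrder.Language.{0, 0}}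
    {L : FirstOrder.Language.{0, 0}} (K : Set (Bundled.{u} (V none).Structure))
    (D : BigDecomp.{u} (fun s => V (some s)) L) : BigDecomp.{u} V (prodVoc L (V none)) :=
  fun A F ρ e => ∃ A₁ ρ₁ e₁, D A₁ (fun s => F (some s)) ρ₁ e₁ ∧ F none ∈ K ∧
    ∃ g : A ≃[prodVoc L (V none)] pairStructure A₁ (F none), ρ = g.symm (pairInl _ _ ρ₁) ∧
      (∀ s x, e (some s) x = g.symm (pairInl _ _ (e₁ s x))) ∧
      ∀ x, e none x = g.symm (pairInr _ _ x)

/-- The root and the old factors lie in the first factor of the pair, the new factor is the second,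
and `SameSide` keeps the two apart. -/
theorem IsBigProd.option {S : Type} {V : Option S → FirstOrder.Language.{0, 0}}
    {KS : ∀ s, Set (Bundled.{u} (V s).Structure)} {L : FirstOrder.Language.{0, 0}}
    {K : Set (Bundled.{u} L.Structure)} {D : BigDecomp.{u} (fun s => V (some s)) L}
    (h : IsBigProd (fun s => KS (some s)) K D) :
    IsBigProd KS (prodClass K (KS none)) (optionDecomp (KS none) D) where
  mem_left := by
    rintro A F ρ e ⟨A₁, ρ₁, e₁, H, hF, g, -⟩
    exact ⟨A₁, h.mem_left H, _, hF, ⟨g⟩⟩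
  mem_part := by
    rintro A F ρ e ⟨A₁, ρ₁, e₁, H, hF, g, -⟩ (_ | s)
    exacts [hF, h.mem_part H s]
  total := by
    rintro A ⟨A₁, hA₁, B, hB, ⟨g⟩⟩
    obtain ⟨F, ρ, e, H⟩ := h.total A₁ hA₁
    refine ⟨fun s => match s with
      | none => B
      | some s => F s, g.symm (pairInl _ _ ρ), fun s => match s with
      | none => fun x => g.symm (pairInr _ _ x)
      | some s => fun x => g.symm (pairInl _ _ (e s x)), A₁, ρ, e, H, hB, g, rfl, ?_, ?_⟩
    · exact fun _ _ => rfl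
    · exact fun _ => rfl
  surj := by
    intro F hF
    obtain ⟨A, ρ, e, H⟩ := h.surj (fun s => F (some s)) fun s => hF (some s)
    refine ⟨pairStructure A (F none), pairInl _ _ ρ, fun s => match s with
      | none => fun x => pairInr _ _ x
      | some s => fun x => pairInl _ _ (e s x), A, ρ, e, H, hF none, Language.Equiv.refl _ _, rfl,
      ?_, ?_⟩
    · exact fun _ _ => rfl
    · exact fun _ => rfl
  ne_root := by
    rintro A F ρ e ⟨A₁, ρ₁, e₁, H, hF, g, rfl, hs, hn⟩ (_ | s) x hx
    · rw [hn] at hx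
      exact pairInl_ne_pairInr _ _ (g.symm.injective hx).symm
    · rw [hs] at hx
      exact h.ne_root H s x (pairInl_injective (g.symm.injective hx))
  index := by
    rintro A F ρ e ⟨A₁, ρ₁, e₁, H, hF, g, rfl, hs, hn⟩ (_ | s) x (_ | s') x' hx
    · rfl
    · rw [hn, hs] at hx
      exact (pairInl_ne_pairInr _ _ (g.symm.injective hx).symm).elim
    · rw [hn, hs] at hx
      exact (pairInl_ne_pairInr _ _ (g.symm.injective hx)).elim
    · rw [hs, hs] at hx
      rw [h.index H (pairInl_injective (g.symm.injective hx))]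
  injective := by
    rintro A F ρ e ⟨A₁, ρ₁, e₁, H, hF, g, rfl, hs, hn⟩ (_ | s) x x' hx
    · rw [hn, hn] at hx
      exact pairInr_injective (g.symm.injective hx)
    · rw [hs, hs] at hx
      exact h.injective H s (pairInl_injective (g.symm.injective hx))
  root := by
    rintro A F ρ e A' F' ρ' e' ⟨A₁, ρ₁, e₁, H, hF, g, rfl, hs, hn⟩
      ⟨A₁', ρ₁', e₁', H', hF', g', rfl, hs', hn'⟩ p hp a' ha
    have hq := hp.pull_equiv_symm g g'
    obtain ⟨z', rfl⟩ := g'.symm.surjective a'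
    obtain ⟨y, rfl⟩ := (SameSide.of_pIsoPos hq).left (a := ρ₁) (z' := z') ha
    rw [h.root H H' (pIsoPos_pull_pairInl hq) ha]
  part := by
    rintro A F ρ e A' F' ρ' e' ⟨A₁, ρ₁, e₁, H, hF, g, rfl, hs, hn⟩
      ⟨A₁', ρ₁', e₁', H', hF', g', rfl, hs', hn'⟩ p hp s x a' ha
    have hq := hp.pull_equiv_symm g g'
    have hss := SameSide.of_pIsoPos hq
    obtain ⟨z', rfl⟩ := g'.symm.surjective a'
    cases s with
    | none =>
      rw [hn] at ha
      obtain ⟨y, rfl⟩ := hss.right (b := x) (z' := z') ha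
      exact ⟨y, (hn' y).symm⟩
    | some s =>
      rw [hs] at ha
      obtain ⟨y, rfl⟩ := hss.left (a := e₁ s x) (z' := z') ha
      obtain ⟨x', rfl⟩ := h.part H H' (pIsoPos_pull_pairInl hq) ha
      exact ⟨x', (hs' s x').symm⟩
  pIsoPos := by
    rintro A F ρ e A' F' ρ' e' ⟨A₁, ρ₁, e₁, H, hF, g, rfl, hs, hn⟩
      ⟨A₁', ρ₁', e₁', H', hF', g', rfl, hs', hn'⟩ p hp s
    have hq := hp.pull_equiv_symm g g'
    cases s with
    | none =>
      refine (pIsoPos_pull_pairInr hq).mono fun z hz => ?_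
      rwa [mem_pull, hn, hn'] at hz
    | some s =>
      refine (h.pIsoPos H H' (pIsoPos_pull_pairInl hq) s).mono fun z hz => ?_
      rwa [mem_pull, hs, hs'] at hz

/-- Stated as existence, so that dependent families can be reindexed by substitution and no casts
appear. -/
theorem exists_comp_equiv_eq {α β : Type} {W : β → Type*} (ε : α ≃ β) (f : ∀ a, W (ε a)) :
    ∃ g : ∀ b, W b, (fun a => g (ε a)) = f :=
  ⟨Equiv.piCongrLeft W ε f, funext fun a => Equiv.piCongrLeft_apply_apply W ε f a⟩

/-- Factors are added one at a time. The empty product is `one`, whose only element is the root. -/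
theorem exists_isBigProd (S : Type) [Finite S] : ∀ τ : S → MultisetType,
    ∃ (γ : MultisetType) (D : BigDecomp.{u} (fun s => (τ s).voc) γ.voc),
      IsBigProd (fun s => (τ s).structures) γ.structures D := by
  induction S using Finite.induction_empty_option with
  | of_equiv ε ih =>
    intro τ
    obtain ⟨γ, D, h⟩ := ih fun s => τ (ε s)
    refine ⟨γ, fun A F ρ e => D A (fun s => F (ε s)) ρ fun s => e (ε s), ?_⟩
    refine ⟨fun H => h.mem_left H, fun H => ε.surjective.forall.2 (h.mem_part H), fun A hA => ?_,
      fun F hF => ?_, fun H => ε.surjective.forall.2 (h.ne_root H), fun {A F ρ e} H s x s' x' hx => ?_,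
      fun H => ε.surjective.forall.2 (h.injective H), fun H H' p hp a' ha => h.root H H' hp ha,
      fun {A F ρ e A' F' ρ' e'} H H' p hp s => ?_,
      fun H H' p hp => ε.surjective.forall.2 (h.pIsoPos H H' hp)⟩
    · obtain ⟨F₀, ρ, e₀, H⟩ := h.total A hA
      obtain ⟨F, rfl⟩ : ∃ F : ∀ s, Bundled (τ s).voc.Structure, (fun s => F (ε s)) = F₀ :=
        exists_comp_equiv_eq (W := fun s => Bundled (τ s).voc.Structure) ε F₀
      obtain ⟨e, rfl⟩ : ∃ e : ∀ s, F s → A, (fun s => e (ε s)) = e₀ :=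
        exists_comp_equiv_eq (W := fun s => F s → A) ε e₀
      exact ⟨F, ρ, e, H⟩
    · obtain ⟨A, ρ, e₀, H⟩ := h.surj (fun s => F (ε s)) fun s => hF (ε s)
      obtain ⟨e, rfl⟩ : ∃ e : ∀ s, F s → A, (fun s => e (ε s)) = e₀ :=
        exists_comp_equiv_eq (W := fun s => F s → A) ε e₀
      exact ⟨A, ρ, e, H⟩
    · obtain ⟨s, rfl⟩ := ε.surjective s
      obtain ⟨s', rfl⟩ := ε.surjective s'
      rw [h.index H hx]
    · obtain ⟨s, rfl⟩ := ε.surjective s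
      exact fun ha => h.part H H' hp ha
  | h_empty =>
    intro τ
    refine ⟨one, fun A _ _ _ => Nat.card A = 1, fun h => h, fun _ s => s.elim, fun A hA => ?_,
      fun F _ => ?_, fun _ s => s.elim, fun _ s => s.elim, fun _ s => s.elim, ?_, fun _ _ _ _ s => s.elim,
      fun _ _ _ _ s => s.elim⟩
    · obtain ⟨a⟩ := (Nat.card_eq_one_iff_unique.1 hA).2
      exact ⟨fun s => s.elim, a, fun s => s.elim, hA⟩
    · exact ⟨⟨PUnit, (emptyStructure : FirstOrder.Language.empty.Structure PUnit)⟩, ⟨⟩,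
        fun s => s.elim, Nat.card_unique⟩
    · exact fun _ H' _ _ _ _ => (Nat.card_eq_one_iff_unique.1 H').1.elim _ _
  | h_option ih =>
    intro τ
    obtain ⟨γ, D, h⟩ := ih fun s => τ (some s)
    exact ⟨γ.prod (τ none), _, h.option⟩

end BigProd

/-! ### Decompositions into components -/

section Decomp

variable {I : Type} {V : I → FirstOrder.Language.{0, 0}}

/-- A family of structures of several kinds, and functions from them into `A`. -/
structure Decomp (V : I → FirstOrder.Language.{0, 0}) (A : Type u) where
  /-- The indices of the components. -/
  J : Type
  /-- The components. -/
  X : J → Σ i, Bundled.{u} (V i).Structure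
  /-- The functions from the components into `A`. -/
  emb : ∀ j, (X j).2 → A

/-- Partial isomorphisms, up to nullary relations, between structures of the same kind. -/
inductive CompIso : (X Y : Σ i, Bundled.{u} (V i).Structure) → Set (X.2 × Y.2) → Prop
  | mk {i : I} {A B : Bundled.{u} (V i).Structure} {p : Set (A × B)} (h : (V i).PIsoPos p) :
      CompIso ⟨i, A⟩ ⟨i, B⟩ p

/-- The decomposition has disjoint injective embeddings. -/
structure Decomp.Disjoint {A : Type u} (d : Decomp.{u} V A) : Prop where
  index : ∀ {j x j' x'}, d.emb j x = d.emb j' x' → j = j'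
  injective : ∀ j, (d.emb j).Injective

/-- The position respects the decompositions. -/
structure Decomp.Compat {A A' : Type u} (d : Decomp.{u} V A) (d' : Decomp.{u} V A')
    (p : Set (A × A')) : Prop where
  mem : ∀ {j x a'}, (d.emb j x, a') ∈ p → ∃ j' x', a' = d'.emb j' x'
  index : ∀ {j x j' x' k y k' y'}, (d.emb j x, d'.emb j' x') ∈ p → (d.emb k y, d'.emb k' y') ∈ p →
    (j = k ↔ j' = k')
  comp : ∀ {j x j' x'}, (d.emb j x, d'.emb j' x') ∈ p →
    CompIso (d.X j) (d'.X j') (pull (d.emb j) (d'.emb j') p)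

/-- The structures in `K` decompose into structures of kind `i`, the number of which is any number
in `N`. -/
structure IsPart (KI : ∀ i, Set (Bundled.{u} (V i).Structure)) {L : FirstOrder.Language.{0, 0}}
    (K : Set (Bundled.{u} L.Structure)) (D : (A : Bundled.{u} L.Structure) → Decomp.{u} V A → Prop)
    (i : I) (N : Set ℕ) : Prop where
  mem : ∀ {A d}, D A d → ∀ j, (d.X j).1 = i ∧ (d.X j).2 ∈ KI (d.X j).1
  finite : ∀ {A d}, D A d → Finite d.J
  card : ∀ {A d}, D A d → Nat.card d.J ∈ N
  disjoint : ∀ {A d}, D A d → d.Disjoint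
  total : ∀ A ∈ K, ∃ d, D A d
  surj : ∀ (J : Type) [Finite J], Nat.card J ∈ N → ∀ X : J → Σ i, Bundled.{u} (V i).Structure,
    (∀ j, (X j).1 = i ∧ (X j).2 ∈ KI (X j).1) →
    ∃ A ∈ K, ∃ d, D A d ∧ ∃ ε : d.J ≃ J, ∀ j, X (ε j) = d.X j
  compat : ∀ {A d A' d'}, D A d → D A' d' → ∀ {p : Set (A × A')}, L.PIsoPos p → d.Compat d' p

theorem isPart_single (KI : ∀ i, Set (Bundled.{u} (V i).Structure)) (i : I) :
    IsPart KI (KI i) (fun A d => A ∈ KI i ∧ d = ⟨Unit, fun _ => ⟨i, A⟩, fun _ => id⟩) i {1} where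
  mem := by
    rintro A d ⟨hA, rfl⟩ j
    exact ⟨rfl, hA⟩
  finite := by
    rintro A d ⟨hA, rfl⟩
    exact inferInstanceAs (Finite Unit)
  card := by
    rintro A d ⟨hA, rfl⟩
    exact Nat.card_unique (α := Unit)
  disjoint := by
    rintro A d ⟨hA, rfl⟩
    exact ⟨fun _ => rfl, fun _ => Function.injective_id⟩
  total := fun A hA => ⟨_, hA, rfl⟩
  surj := by
    intro J _ hJ X hX
    obtain ⟨hs, ⟨j₀⟩⟩ := Nat.card_eq_one_iff_unique.1 hJ
    obtain ⟨rfl, hA⟩ := hX j₀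
    refine ⟨_, hA, _, ⟨hA, rfl⟩, ⟨fun _ => j₀, fun _ => (), fun _ => rfl, fun _ => hs.elim _ _⟩, ?_⟩
    exact fun _ => rfl
  compat := by
    rintro A d A' d' ⟨hA, rfl⟩ ⟨hA', rfl⟩ p hp
    exact ⟨fun {_ _ a'} _ => ⟨(), a', rfl⟩, fun _ _ => iff_of_true rfl rfl, fun _ => .mk hp⟩

/-- The name `sim` is binary and carries everything: `sim z z` says that `z` is not the root, and
`sim z w` that both lie in one component. The root of this multiset belongs to no component of the
decomposition. -/
theorem isPart_multiset (KI : ∀ i, Set (Bundled.{u} (V i).Structure)) (i : I) :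
    IsPart KI (multisetClass (KI i)) (fun A d => ∃ (m : ℕ) (G : Fin m → Bundled.{u} (V i).Structure),
      (∀ k, G k ∈ KI i) ∧ ∃ g : A ≃[multisetVoc (V i)] multisetStr G,
        d = ⟨Fin m, fun k => ⟨i, G k⟩, fun k x => g.symm (multisetEmb G k x)⟩) i Set.univ where
  mem := by
    rintro A d ⟨m, G, hG, g, rfl⟩ j
    exact ⟨rfl, hG j⟩
  finite := by
    rintro A d ⟨m, G, hG, g, rfl⟩
    exact inferInstanceAs (Finite (Fin m))
  card := fun _ => trivial
  disjoint := by
    rintro A d ⟨m, G, hG, g, rfl⟩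
    exact ⟨fun h => index_eq_of_multisetEmb_eq (g.symm.injective h),
      fun j => g.symm.injective.comp (multisetEmb_injective j)⟩
  total := by
    intro A hA
    obtain ⟨m, G, hG, ⟨g⟩⟩ := exists_equiv_multisetStr hA
    exact ⟨_, m, G, hG, g, rfl⟩
  surj := by
    intro J _ _ X hX
    obtain ⟨m, ⟨ε⟩⟩ := Finite.exists_equiv_fin J
    have h : ∀ k : Fin m, ∃ G ∈ KI i, X (ε.symm k) = ⟨i, G⟩ := fun k => by
      obtain ⟨rfl, h⟩ := hX (ε.symm k)
      exact ⟨_, h, rfl⟩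
    choose G hG hXG using h
    exact ⟨multisetStr G, mem_multisetClass_of_equiv_multisetStr hG (Language.Equiv.refl _ _), _,
      ⟨m, G, hG, Language.Equiv.refl _ _, rfl⟩, ε.symm, hXG⟩
  compat := by
    rintro A d A' d' ⟨m, G, hG, g, rfl⟩ ⟨m', G', hG', g', rfl⟩ p hp
    have hq := hp.pull_equiv_symm g g'
    have hsim : ∀ {z z' w w'}, (z, z') ∈ pull g.symm g'.symm p → (w, w') ∈ pull g.symm g'.symm p →
        ((∃ j a b, z = multisetEmb G j a ∧ w = multisetEmb G j b) ↔
          ∃ j a b, z' = multisetEmb G' j a ∧ w' = multisetEmb G' j b) := by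
      intro z z' w w' hz hw
      rw [← relMap_sim, ← relMap_sim]
      exact hq.rel_iff (k := 1) MultisetRel.sim ![z, w] ![z', w'] (Fin.forall_fin_two.2 ⟨hz, hw⟩)
    refine ⟨fun {j x a'} ha => ?_, fun {j x j' x' k y k' y'} h₁ h₂ => ?_, fun {j x j' x'} h => .mk ?_⟩
    · obtain ⟨z', rfl⟩ := g'.symm.surjective a'
      obtain ⟨j', x', -, rfl, -⟩ := (hsim (z' := z') ha ha).1 ⟨j, x, x, rfl, rfl⟩
      exact ⟨j', x', rfl⟩
    · have := hsim h₁ h₂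
      constructor
      · rintro rfl
        obtain ⟨l, a, b, h, h'⟩ := this.1 ⟨j, x, y, rfl, rfl⟩
        exact (index_eq_of_multisetEmb_eq h).trans (index_eq_of_multisetEmb_eq h').symm
      · rintro rfl
        obtain ⟨l, a, b, h, h'⟩ := this.2 ⟨j', x', y', rfl, rfl⟩
        exact (index_eq_of_multisetEmb_eq h).trans (index_eq_of_multisetEmb_eq h').symm
    · refine ⟨fun h₁ h₂ => ?_, fun R v w hvw => ?_⟩
      · rw [← (multisetEmb_injective (B := G) j).eq_iff, ← (multisetEmb_injective (B := G') j').eq_iff]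
        exact hq.eq_iff h₁ h₂
      · rw [← relMap_old (B := G), ← relMap_old (B := G')]
        exact hq.rel_iff (MultisetRel.old R) _ _ hvw

/-- A decomposition into parts, refined by decompositions of the parts. -/
def Decomp.bind {S : Type} {VS : S → FirstOrder.Language.{0, 0}}
    {F : ∀ s, Bundled.{u} (VS s).Structure} {A : Type u} (e : ∀ s, F s → A)
    (d : ∀ s, Decomp.{u} V (F s)) : Decomp.{u} V A :=
  ⟨Σ s, (d s).J, fun z => (d z.1).X z.2, fun z x => e z.1 ((d z.1).emb z.2 x)⟩

/-- The structures in `K` consist of a root and of finitely many components from the classes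
`KI i`, with numbers of components that are similar up to `N`. -/
structure IsRooted (N : ℕ) (KI : ∀ i, Set (Bundled.{u} (V i).Structure))
    {L : FirstOrder.Language.{0, 0}} (K : Set (Bundled.{u} L.Structure))
    (D : (A : Bundled.{u} L.Structure) → A → Decomp.{u} V A → Prop) : Prop where
  mem_left : ∀ {A ρ d}, D A ρ d → A ∈ K
  mem : ∀ {A ρ d}, D A ρ d → ∀ j, (d.X j).2 ∈ KI (d.X j).1
  finite : ∀ {A ρ d}, D A ρ d → Finite d.J
  disjoint : ∀ {A ρ d}, D A ρ d → d.Disjoint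
  ne_root : ∀ {A ρ d}, D A ρ d → ∀ j x, d.emb j x ≠ ρ
  total : ∀ A ∈ K, ∃ ρ d, D A ρ d
  similar : ∀ {A ρ d A' ρ' d'}, D A ρ d → D A' ρ' d' →
    SimilarCount (fun j => (d.X j).1) (fun j => (d'.X j).1) N
  root : ∀ {A ρ d A' ρ' d'}, D A ρ d → D A' ρ' d' → ∀ {p : Set (A × A')}, L.PIsoPos p →
    ∀ {a'}, (ρ, a') ∈ p → a' = ρ'
  compat : ∀ {A ρ d A' ρ' d'}, D A ρ d → D A' ρ' d' → ∀ {p : Set (A × A')}, L.PIsoPos p →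
    d.Compat d' p

/-! ### Rooted products and the numbers of their components. -/

section Parts

variable {S : Type} {VS : S → FirstOrder.Language.{0, 0}}
  {KI : ∀ i, Set (Bundled.{u} (V i).Structure)} {KS : ∀ s, Set (Bundled.{u} (VS s).Structure)}
  {L : FirstOrder.Language.{0, 0}} {K : Set (Bundled.{u} L.Structure)} {D : BigDecomp.{u} VS L}
  {PD : ∀ s, (A : Bundled.{u} (VS s).Structure) → Decomp.{u} V A → Prop} {col : S → I}
  {Ns : S → Set ℕ}

/-- The decompositions that arise from a product by decomposing its factors. -/
def bindDecomp (D : BigDecomp.{u} VS L)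
    (PD : ∀ s, (A : Bundled.{u} (VS s).Structure) → Decomp.{u} V A → Prop)
    (A : Bundled.{u} L.Structure) (ρ : A) (d : Decomp.{u} V A) : Prop :=
  ∃ F e, D A F ρ e ∧ ∃ f : ∀ s, Decomp.{u} V (F s), (∀ s, PD s (F s) (f s)) ∧ d = Decomp.bind e f

/-- Under `hN`, every colour either has only single factors, which fixes its number of components,
or has at least `N` single factors, which already gives `N` components. Partial isomorphisms keep
each element in its factor, so compatibility is checked factor by factor. -/
theorem IsBigProd.isRooted [Finite S] {N : ℕ} (hD : IsBigProd KS K D)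
    (hP : ∀ s, IsPart KI (KS s) (PD s) (col s) (Ns s))
    (hN : ∀ i, (∀ s, col s = i → Ns s = {1}) ∨ N ≤ {s | col s = i ∧ Ns s = {1}}.ncard) :
    IsRooted N KI K (bindDecomp D PD) where
  mem_left := by
    rintro A ρ d ⟨F, e, H, f, hf, rfl⟩
    exact hD.mem_left H
  mem := by
    rintro A ρ d ⟨F, e, H, f, hf, rfl⟩ ⟨s, j⟩
    exact ((hP s).mem (hf s) j).2
  finite := by
    rintro A ρ d ⟨F, e, H, f, hf, rfl⟩
    have := fun s => (hP s).finite (hf s)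
    exact inferInstanceAs (Finite (Σ s, (f s).J))
  disjoint := by
    rintro A ρ d ⟨F, e, H, f, hf, rfl⟩
    refine ⟨?_, fun j => (hD.injective H j.1).comp (((hP j.1).disjoint (hf j.1)).injective j.2)⟩
    rintro ⟨s, j⟩ x ⟨s', j'⟩ x' hx
    obtain rfl : s = s' := hD.index H hx
    exact congrArg (Sigma.mk s) (((hP s).disjoint (hf s)).index (hD.injective H s hx))
  ne_root := by
    rintro A ρ d ⟨F, e, H, f, hf, rfl⟩ j x
    exact hD.ne_root H _ _
  total := by
    intro A hA
    obtain ⟨F, ρ, e, H⟩ := hD.total A hA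
    choose f hf using fun s => (hP s).total (F s) (hD.mem_part H s)
    exact ⟨ρ, _, F, e, H, f, hf, rfl⟩
  similar := by
    have hle : ∀ {A ρ d}, bindDecomp D PD A ρ d → ∀ i,
        {s | col s = i ∧ Ns s = {1}}.ncard ≤ {j | (d.X j).1 = i}.ncard := by
      rintro A ρ d ⟨F, e, H, f, hf, rfl⟩ i
      have := fun s => (hP s).finite (hf s)
      have : Finite (Decomp.bind e f).J := inferInstanceAs (Finite (Σ s, (f s).J))
      refine (Set.ncard_le_ncard ?_).trans (Set.ncard_image_le (f := Sigma.fst))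
      rintro s ⟨rfl, hs⟩
      have h1 := (hP s).card (hf s)
      rw [hs] at h1
      obtain ⟨-, ⟨j⟩⟩ := Nat.card_eq_one_iff_unique.1 h1
      exact ⟨⟨s, j⟩, ((hP s).mem (hf s) j).1, rfl⟩
    have heq : ∀ {A ρ d}, bindDecomp D PD A ρ d → ∀ i, (∀ s, col s = i → Ns s = {1}) →
        {j | (d.X j).1 = i}.ncard = {s | col s = i}.ncard := by
      intro A ρ d hd i hi
      refine le_antisymm ?_ ?_
      · obtain ⟨F, e, H, f, hf, rfl⟩ := hd
        refine Set.ncard_le_ncard_of_injOn Sigma.fst ?_ ?_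
        · rintro ⟨s, j⟩ h
          exact ((hP s).mem (hf s) j).1.symm.trans h
        · rintro ⟨s, j⟩ h ⟨s', j'⟩ - hs
          obtain rfl : s = s' := hs
          have h1 := (hP s).card (hf s)
          rw [hi s (((hP s).mem (hf s) j).1.symm.trans h)] at h1
          rw [(Nat.card_eq_one_iff_unique.1 h1).1.elim j j']
      · refine le_trans (Set.ncard_le_ncard ?_) (hle hd i)
        exact fun s hs => ⟨hs, hi s hs⟩
    intro A ρ d A' ρ' d' hd hd' i
    rcases hN i with hi | hi
    · exact Or.inl ((heq hd i hi).trans (heq hd' i hi).symm)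
    · exact Or.inr ⟨hi.trans (hle hd i), hi.trans (hle hd' i)⟩
  root := by
    rintro A ρ d A' ρ' d' ⟨F, e, H, f, hf, rfl⟩ ⟨F', e', H', f', hf', rfl⟩ p hp a' ha
    exact hD.root H H' hp ha
  compat := by
    rintro A ρ d A' ρ' d' ⟨F, e, H, f, hf, rfl⟩ ⟨F', e', H', f', hf', rfl⟩ p hp
    have hc := fun s => (hP s).compat (hf s) (hf' s) (hD.pIsoPos H H' hp s)
    have hs : ∀ {s x s' x'}, (e s x, e' s' x') ∈ p → s = s' := by
      intro s x s' x' h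
      obtain ⟨y, hy⟩ := hD.part H H' hp h
      exact (hD.index H' hy).symm
    refine ⟨?_, ?_, ?_⟩
    · rintro ⟨s, j⟩ x a' ha
      obtain ⟨y, rfl⟩ := hD.part H H' hp ha
      obtain ⟨j', x', rfl⟩ := (hc s).mem ha
      exact ⟨⟨s, j'⟩, x', rfl⟩
    · rintro ⟨s, j⟩ x ⟨s', j'⟩ x' ⟨t, k⟩ y ⟨t', k'⟩ y' h₁ h₂
      obtain rfl : s = s' := hs h₁
      obtain rfl : t = t' := hs h₂
      by_cases hst : s = t
      · subst hst
        have := (hc s).index h₁ h₂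
        constructor
        · exact fun h => congrArg (Sigma.mk s) (this.1 (eq_of_heq (Sigma.mk.inj h).2))
        · exact fun h => congrArg (Sigma.mk s) (this.2 (eq_of_heq (Sigma.mk.inj h).2))
      · exact iff_of_false (fun h => hst (Sigma.mk.inj h).1) (fun h => hst (Sigma.mk.inj h).1)
    · rintro ⟨s, j⟩ x ⟨s', j'⟩ x' h
      obtain rfl : s = s' := hs h
      exact (hc s).comp h

/-- The map `q` sends each component to the factor that is to hold it; the factor `s` is built from
the fibre of `q` over `s`, whose size must be admissible. -/
theorem IsBigProd.exists_bindDecomp (hD : IsBigProd KS K D)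
    (hP : ∀ s, IsPart KI (KS s) (PD s) (col s) (Ns s)) {J : Type} [Finite J]
    (X : J → Σ i, Bundled.{u} (V i).Structure) (hX : ∀ j, (X j).2 ∈ KI (X j).1) (q : J → S)
    (hq : ∀ j, (X j).1 = col (q j)) (hN : ∀ s, Nat.card {j // q j = s} ∈ Ns s) :
    ∃ A ρ d, bindDecomp D PD A ρ d ∧ ∃ ε : d.J ≃ J, ∀ j, X (ε j) = d.X j := by
  have h := fun s => (hP s).surj {j // q j = s} (hN s) (fun j => X j.1) fun j =>
    ⟨(hq j.1).trans (congrArg col j.2), hX j.1⟩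
  choose F hF f hf ε hε using h
  obtain ⟨A, ρ, e, H⟩ := hD.surj F hF
  refine ⟨A, ρ, _, ⟨F, e, H, f, hf, rfl⟩, (Equiv.sigmaCongrRight ε).trans (Equiv.sigmaFiberEquiv q), ?_⟩
  rintro ⟨s, j⟩
  exact hε s j

end Parts

/-- The elements of every colour can be numbered. -/
theorem exists_numbering {J : Type} [Finite J] (col : J → I) : ∃ num : J → ℕ,
    (∀ j, num j < {k | col k = col j}.ncard) ∧
      ∀ i, ∀ n < {k | col k = i}.ncard, ∃! j, col j = i ∧ num j = n := by
  have h : ∀ i, Nonempty ({k // col k = i} ≃ Fin ({k | col k = i}.ncard)) := fun i =>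
    ⟨Finite.equivFinOfCardEq rfl⟩
  have φ := fun i => (h i).some
  have hφ : ∀ {i j} (hj : col j = i), (φ (col j) ⟨j, rfl⟩ : ℕ) = φ i ⟨j, hj⟩ := by
    rintro i j rfl
    rfl
  refine ⟨fun j => φ (col j) ⟨j, rfl⟩, fun j => (φ (col j) ⟨j, rfl⟩).2, fun i n hn => ?_⟩
  refine ⟨(φ i).symm ⟨n, hn⟩, ⟨((φ i).symm ⟨n, hn⟩).2, ?_⟩, ?_⟩
  · refine (hφ ((φ i).symm ⟨n, hn⟩).2).trans ?_
    simp
  · rintro j ⟨hj, hn'⟩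
    rw [show (⟨n, hn⟩ : Fin _) = φ i ⟨j, hj⟩ from Fin.ext (hn'.symm.trans (hφ hj))]
    simp

end Decomp

/-- One type for each vector of counts truncated at `N`; a given family is realised by the type of
its own vector. -/
theorem exists_isRooted {I : Type} [Finite I] (γ : I → MultisetType) (N : ℕ) :
    ∃ (δ : (I → Fin (N + 1)) → MultisetType)
      (D : ∀ c, (A : Bundled.{u} (δ c).voc.Structure) → A → Decomp.{u} (fun i => (γ i).voc) A → Prop),
      (∀ c, IsRooted N (fun i => (γ i).structures) (δ c).structures (D c)) ∧
      ∀ (J : Type) [Finite J] (X : J → Σ i, Bundled.{u} (γ i).voc.Structure),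
        (∀ j, (X j).2 ∈ (γ (X j).1).structures) →
        ∃ c A ρ d, D c A ρ d ∧ ∃ ε : d.J ≃ J, ∀ j, X (ε j) = d.X j := by
  -- The factors of colour `i`: `c i` single ones, and one multiset factor exactly when `c i = N`.
  let S : (I → Fin (N + 1)) → Type := fun c => Σ i, Fin (c i) ⊕ PLift ((c i : ℕ) = N)
  let Ns : Bool → Set ℕ := fun b => if b then {1} else Set.univ
  have hpart : ∀ (i : I) (b : Bool), ∃ (τ : MultisetType)
      (PD : (A : Bundled.{u} τ.voc.Structure) → Decomp.{u} (fun i => (γ i).voc) A → Prop),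
      IsPart (fun i => (γ i).structures) τ.structures PD i (Ns b) := by
    rintro i (_ | _)
    · exact ⟨(γ i).multiset, _, isPart_multiset _ i⟩
    · exact ⟨γ i, _, isPart_single (fun i => (γ i).structures) i⟩
  choose τ PD hPD using hpart
  choose δ D hD using fun c => exists_isBigProd.{u} (S c) fun s => τ s.1 s.2.isLeft
  have hP := fun c (s : S c) => hPD s.1 s.2.isLeft
  refine ⟨δ, fun c => bindDecomp (D c) fun s => PD s.1 s.2.isLeft, fun c => (hD c).isRooted (hP c) ?_,
    fun J _ X hX => ?_⟩
  · intro i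
    by_cases hi : (c i : ℕ) = N
    · right
      have hinj : Function.Injective fun k : Fin (c i) => (⟨i, Sum.inl k⟩ : S c) := by
        intro k l h
        simpa using h
      calc N = (Set.range fun k : Fin (c i) => (⟨i, Sum.inl k⟩ : S c)).ncard := by
            rw [← Set.image_univ, Set.ncard_image_of_injective _ hinj, Set.ncard_univ]
            simp [hi]
        _ ≤ _ := Set.ncard_le_ncard (by
            rintro _ ⟨k, rfl⟩
            exact ⟨rfl, rfl⟩)
    · left
      rintro ⟨i', k | ⟨⟨h⟩⟩⟩ rfl
      · rfl
      · exact (hi h).elim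
  · obtain ⟨num, hnum, huniq⟩ := exists_numbering fun j => (X j).1
    let n : I → ℕ := fun i => {j | (X j).1 = i}.ncard
    -- The true counts, cut off at the threshold.
    let c : I → Fin (N + 1) := fun i => ⟨min (n i) N, by omega⟩
    have hc : ∀ j, ¬ num j < c (X j).1 → (c (X j).1 : ℕ) = N := by
      intro j hj
      have h₁ : num j < n (X j).1 := hnum j
      change ¬ num j < min (n (X j).1) N at hj
      change min (n (X j).1) N = N
      omega
    -- The first `c i` components of colour `i` fill the single factors. Any further one exists only
    -- if the count was cut off, and then the multiset factor is available.
    let q : J → S c := fun j => ⟨(X j).1,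
      if h : num j < c (X j).1 then Sum.inl ⟨num j, h⟩ else Sum.inr ⟨hc j h⟩⟩
    have hq : ∀ j i (k : Fin (c i)), q j = ⟨i, Sum.inl k⟩ ↔ (X j).1 = i ∧ num j = k := by
      intro j i k
      constructor
      · intro h
        obtain rfl : (X j).1 = i := (Sigma.mk.inj h).1
        have h' := eq_of_heq (Sigma.mk.inj h).2
        by_cases hj : num j < c (X j).1
        · rw [dif_pos hj] at h'
          exact ⟨rfl, congrArg Fin.val (Sum.inl_injective h')⟩
        · rw [dif_neg hj] at h'
          exact (Sum.inr_ne_inl h').elim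
      · rintro ⟨rfl, h⟩
        have hj : num j < c (X j).1 := h ▸ k.2
        simp only [q, dif_pos hj]
        congr 2
        exact Fin.ext h
    refine ⟨c, (hD c).exists_bindDecomp (hP c) X hX q (fun j => rfl) ?_⟩
    rintro ⟨i, k | k⟩
    · obtain ⟨j, hj, hj'⟩ := huniq i k (lt_of_lt_of_le k.2 (min_le_left _ _))
      refine Nat.card_eq_one_iff_unique.2 ⟨⟨?_⟩, ⟨⟨j, (hq j i k).2 hj⟩⟩⟩
      rintro ⟨a, ha⟩ ⟨b, hb⟩
      exact Subtype.ext ((hj' a ((hq a i k).1 ha)).trans (hj' b ((hq b i k).1 hb)).symm)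
    · trivial

/-! ### Multiset types have covers -/

section MultisetPres

variable {I : Type} {V : I → FirstOrder.Language.{0, 0}} {L L' : FirstOrder.Language.{0, 0}}
  {KI : ∀ i, Set (Bundled.{u} (V i).Structure)} {K : Set (Bundled.{u} L.Structure)}
  {K' : Set (Bundled.{u} L'.Structure)}
  {D : (A : Bundled.{u} L.Structure) → A → Decomp.{u} V A → Prop} {P : ∀ i, Pres.{u} (V i) L'}
  {N : ℕ}

/-- A partial isomorphism of components includes the fact that their kinds agree, so a single
presentation is in play on both sides. -/
theorem CompIso.range_iff (hP : ∀ i, IsPosPres N (KI i) K' (P i))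
    {X Y : Σ i, Bundled.{u} (V i).Structure} {p : Set (X.2 × Y.2)} (h : CompIso X Y p) {B B' e e'}
    (H : P X.1 X.2 B e) (H' : P Y.1 Y.2 B' e') {a a'} (ha : (a, a') ∈ p) :
    a ∈ Set.range e ↔ a' ∈ Set.range e' := by
  cases h with
  | mk h => exact (hP _).range_iff H H' h ha

theorem CompIso.ef (hP : ∀ i, IsPosPres N (KI i) K' (P i))
    {X Y : Σ i, Bundled.{u} (V i).Structure} {p : Set (X.2 × Y.2)} (h : CompIso X Y p) {B B' e e'}
    (H : P X.1 X.2 B e) (H' : P Y.1 Y.2 B' e') {r : ℕ} (hr : p.encard + r ≤ N) :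
    L'.EF r (pull e e' p) := by
  cases h with
  | mk h => exact (hP _).ef H H' h hr

theorem CompIso.fst_eq {X Y : Σ i, Bundled.{u} (V i).Structure} {p : Set (X.2 × Y.2)}
    (h : CompIso X Y p) : X.1 = Y.1 := by
  cases h with
  | mk h => rfl

theorem CompIso.empty {X Y : Σ i, Bundled.{u} (V i).Structure} (h : X.1 = Y.1) :
    CompIso X Y ∅ := by
  obtain ⟨i, A⟩ := X
  obtain ⟨j, B⟩ := Y
  obtain rfl : i = j := h
  exact .mk PIsoPos.empty

/-- The function from a multiset that is given by a root and by functions on the components. -/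
def multisetElim {J : Type} {B : J → Bundled.{u} L'.Structure} {A : Type u} (ρ : A)
    (f : ∀ j, B j → A) (z : multisetStr B) : A :=
  Option.elim (show Option (Σ j, B j) from z) ρ fun z => f z.1 z.2

/-- Presentations of the components give a presentation of the multiset. -/
def multisetPres (D : (A : Bundled.{u} L.Structure) → A → Decomp.{u} V A → Prop)
    (P : ∀ i, Pres.{u} (V i) L') : Pres.{u} L (multisetVoc L') := fun A M e =>
  ∃ ρ d, D A ρ d ∧ ∃ (B : d.J → Bundled.{u} L'.Structure) (f : ∀ j, B j → (d.X j).2),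
    (∀ j, P (d.X j).1 (d.X j).2 (B j) (f j)) ∧ ∃ g : M ≃[multisetVoc L'] multisetStr B,
      ∀ z, e z = multisetElim ρ (fun j b => d.emb j (f j b)) (g z)

/-- A position on the presenting structures matches the components that contain its elements. This
matching has no more pairs than the position, and within matched components the presentations `P i`
give winning positions. -/
theorem IsRooted.isPosPres (hD : IsRooted N KI K D) (hP : ∀ i, IsPosPres N (KI i) K' (P i)) :
    IsPosPres N K (multisetClass K') (multisetPres D P) where
  mem_left := by
    rintro A M e ⟨ρ, d, H, -⟩
    exact hD.mem_left H
  mem_right := by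
    rintro A M e ⟨ρ, d, H, B, f, hf, g, -⟩
    have := hD.finite H
    exact mem_multisetClass_of_equiv_multisetStr (fun j => (hP _).mem_right (hf j)) g
  injective := by
    rintro A M e ⟨ρ, d, H, B, f, hf, g, he⟩ z w h
    rw [he, he] at h
    refine g.injective ?_
    rcases multiset_cases (g z) with hz | ⟨j, b, hz⟩ <;>
      rcases multiset_cases (g w) with hw | ⟨k, c, hw⟩ <;> rw [hz, hw] at h ⊢
    · exact (hD.ne_root H _ _ h.symm).elim
    · exact (hD.ne_root H _ _ h).elim
    · obtain rfl : j = k := (hD.disjoint H).index h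
      exact congrArg (multisetEmb B j) ((hP _).injective (hf j) ((hD.disjoint H).injective j h))
  total := by
    intro A hA
    obtain ⟨ρ, d, H⟩ := hD.total A hA
    choose B f hf using fun j => (hP _).total _ (hD.mem H j)
    exact ⟨multisetStr B, _, ρ, d, H, B, f, hf, Language.Equiv.refl _ _, fun _ => rfl⟩
  range_iff := by
    have key : ∀ {A M e A' M' e'}, multisetPres D P A M e → multisetPres D P A' M' e' →
        ∀ {p : Set (A × A')}, L.PIsoPos p → ∀ {a a'}, (a, a') ∈ p → a ∈ Set.range e →
        a' ∈ Set.range e' := by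
      rintro A M e A' M' e' ⟨ρ, d, H, B, f, hf, g, he⟩ ⟨ρ', d', H', B', f', hf', g', he'⟩ p hp _ a' ha
        ⟨z, rfl⟩
      rw [he] at ha
      rcases multiset_cases (g z) with hz | ⟨j, b, hz⟩ <;> rw [hz] at ha
      · obtain rfl := hD.root H H' hp ha
        exact ⟨g'.symm (multisetRoot B'), by rw [he']; simp; rfl⟩
      · have hc := hD.compat H H' hp
        obtain ⟨j', x', rfl⟩ := hc.mem ha
        obtain ⟨b', rfl⟩ := ((hc.comp ha).range_iff hP (hf j) (hf' j') ha).1 ⟨b, rfl⟩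
        exact ⟨g'.symm (multisetEmb B' j' b'), by rw [he']; simp; rfl⟩
    intro A M e A' M' e' H H' p hp a a' ha
    exact ⟨key H H' hp ha, key H' H hp.swap ha⟩
  ef := by
    rintro A M e A' M' e' ⟨ρ, d, H, B, f, hf, g, he⟩ ⟨ρ', d', H', B', f', hf', g', he'⟩ p hp r hr
    have := hD.finite H
    have := hD.finite H'
    have hc := hD.compat H H' hp
    let q : Set (multisetStr B × multisetStr B') :=
      pull (multisetElim ρ fun j b => d.emb j (f j b)) (multisetElim ρ' fun j b => d'.emb j (f' j b)) p
    have hq : Matched B B' (fun j => (d.X j).1) (fun j => (d'.X j).1) N r q := by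
      let π : Set (d.J × d'.J) := {w | ∃ x x', (d.emb w.1 x, d'.emb w.2 x') ∈ p}
      have hπ : π.encard ≤ p.encard := by
        -- Each matched pair of components is charged to a pair of `p` that witnesses it; by
        -- disjointness that pair determines the components.
        choose x x' hx using fun w : π => w.2
        refine Function.Embedding.encard_le ⟨fun w => ⟨_, hx w⟩, fun v w h => ?_⟩
        obtain ⟨h, h'⟩ := Prod.mk.inj (Subtype.mk.inj h)
        exact Subtype.ext (Prod.ext ((hD.disjoint H).index h) ((hD.disjoint H').index h'))
      refine ⟨π, (add_le_add_left hπ _).trans hr, ?_, ?_, ?_, ?_⟩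
      · rintro v ⟨x, x', hx⟩ w ⟨y, y', hy⟩
        exact hc.index hx hy
      · rintro w ⟨x, x', hx⟩
        exact (hc.comp hx).fst_eq
      · intro z z' hz
        rcases multiset_cases z with rfl | ⟨j, b, rfl⟩
        · left
          refine ⟨rfl, ?_⟩
          rcases multiset_cases z' with rfl | ⟨j', b', rfl⟩
          · rfl
          · exact (hD.ne_root H' _ _ (hD.root H H' hp hz)).elim
        · right
          rcases multiset_cases z' with rfl | ⟨j', b', rfl⟩
          · exact (hD.ne_root H _ _ (hD.root H' H hp.swap hz)).elim
          · exact ⟨(j, j'), ⟨_, _, hz⟩, b, b', rfl, rfl⟩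
      · rintro w ⟨x, x', hx⟩
        refine (hc.comp hx).ef hP (hf _) (hf' _) (le_trans ?_ hr)
        exact add_le_add_left (encard_pull_le ((hD.disjoint H).injective _)
          ((hD.disjoint H').injective _)) _
    -- Components of one kind cannot be told apart in up to `N` rounds: the empty position is a
    -- partial isomorphism because nullary names are ignored.
    have hE := hq.ef (hD.similar H H') fun j j' hj s hs =>
      ((CompIso.empty hj).ef hP (hf j) (hf' j') (r := s) (by simpa using hs)).mono (Set.empty_subset _)
    refine (hE.pull_equiv g g').mono fun z hz => ?_
    rw [mem_pull, he, he'] at hz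
    exact hz

theorem exists_multisetPres {A ρ d} (H : D A ρ d) {J : Type} (ε : d.J ≃ J)
    {B : J → Bundled.{u} L'.Structure} (hB : ∀ j, ∃ f, P (d.X j).1 (d.X j).2 (B (ε j)) f)
    {M : Bundled.{u} (multisetVoc L').Structure} (g : M ≃[multisetVoc L'] multisetStr B) :
    ∃ e, multisetPres D P A M e := by
  choose f hf using hB
  obtain ⟨g'⟩ := nonempty_multisetStr_equiv ε B
  exact ⟨_, ρ, d, H, fun j => B (ε j), f, hf, g'.symm.comp g, fun _ => rfl⟩

end MultisetPres

/-- The index set is that of the truncated count vectors, finite because the cover of `σ` is. Each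
component gets as its colour some member of that cover presenting it. -/
theorem HasCover.multiset {N : ℕ} {σ : MultisetType} (h : HasCover.{u} N σ) :
    HasCover.{u} N σ.multiset := by
  obtain ⟨I, _, _, γ, P, hP, hS⟩ := h
  obtain ⟨δ, D, hD, hDS⟩ := exists_isRooted.{u} γ N
  refine ⟨I → Fin (N + 1), inferInstance, inferInstance, δ, fun c => multisetPres (D c) P,
    fun c => (hD c).isPosPres hP, fun M hM => ?_⟩
  obtain ⟨m, B, hB, ⟨g⟩⟩ := exists_equiv_multisetStr hM
  have hX : ∀ j, ∃ X : Σ i, Bundled.{u} (γ i).voc.Structure, ∃ f, P X.1 X.2 (B j) f := fun j => by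
    obtain ⟨i, A, f, hf⟩ := hS (B j) (hB j)
    exact ⟨⟨i, A⟩, f, hf⟩
  choose X hX using hX
  obtain ⟨c, A, ρ, d, H, ε, hε⟩ := hDS (Fin m) X fun j => by
    obtain ⟨f, hf⟩ := hX j
    exact (hP _).mem_left hf
  have hf : ∀ j, ∃ f, P (d.X j).1 (d.X j).2 (B (ε j)) f := fun j => hε j ▸ hX (ε j)
  obtain ⟨e, he⟩ := exists_multisetPres H ε hf g
  exact ⟨c, A, e, he⟩

theorem hasCover (N : ℕ) : ∀ σ : MultisetType, HasCover.{u} N σ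
  | one => hasCover_one N
  | sum σ τ => (hasCover N σ).sum (hasCover N τ)
  | prod σ τ => (hasCover N σ).prod (hasCover N τ)
  | multiset σ => (hasCover N σ).multiset

end MultisetType

theorem mainTheorem6 (σ : MultisetType) (r n : ℕ) :
    ∃ (γ : MultisetType) (f : NonCopyingInterpretation γ.voc σ.voc),
      f.MapsClass γ.structures.{u} σ.structures.{u} ∧
      f.SurjectiveOnClass γ.structures.{u} σ.structures.{u} ∧
      ∀ φ : σ.voc.Formula (Fin n), quantifierRank φ ≤ r →
        ∃ ψ : γ.voc.Formula (Fin n), ψ.IsQF ∧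
          ∀ A ∈ γ.structures.{u}, ∀ a : Fin n → A,
            ψ.Realize a ↔
              ∃ h : ∀ i, f.InUniverse A (a i),
                φ.Realize (M := f.apply A) fun i => ⟨a i, h i⟩ := by
  have := MultisetType.finite_relations σ
  -- `b` bounds the arities of the finite vocabulary, so `max (n + r) b` serves both the formulas
  -- `φ` and the relations of the output.
  obtain ⟨b, hb⟩ := (Set.finite_range (fun R : Σ k, σ.voc.Relations k => R.1)).bddAbove
  exact MultisetType.exists_quantifierElimination (N := max (n + r) b) r n (le_max_left _ _)
    (fun k ⟨R⟩ => (hb ⟨⟨k, R⟩, rfl⟩).trans (le_max_right _ _)) (MultisetType.hasCover _ σ)
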